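/- Let $(\Sigma,\partial)$ be a differential field of characteristic zero whose field of constants $\mathbf C$ is algebraically closed, and let $\Sigma[\partial]$ be the ring of linear differential operators with coefficients in $\Sigma$. Let $L\in\Sigma[\partial]$ have order $3$, let $\mathcal Z(L)=\{A\in\Sigma[\partial] : LA=AL\}$ be its centralizer, and suppose that $A_1,A_2\in\Sigma[\partial]$ are such that $\{1,A_1,A_2\}$ is a basis of $\mathcal Z(L)$ as a $\mathbf C[L]$-module. Let $\mathrm{BC}=\{g\in\mathbf C[\lambda,\mu_1,\mu_2] : g(L,A_1,A_2)=0\}$ and let $[\mathrm{BC}]$ be the ideal generated by $\mathrm{BC}$ in $\Sigma[\lambda,\mu_1,\mu_2]$. The derivation of $\Sigma$ is extended to $\Sigma[\lambda,\mu_1,\mu_2]$ by $\partial\lambda=\partial\mu_1=\partial\mu_2=0$; it preserves $[\mathrm{BC}]$, so it induces derivations of the quotient $\Sigma[\Gamma]=\Sigma[\lambda,\mu_1,\mu_2]/[\mathrm{BC}]$ and of its ring of fractions $\Sigma(\Gamma)$. For operators $P,Q$ of orders $n,m\ge 1$ over a commutative differential ring, let $S_1$ be the matrix with $n+m-2$ rows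 and $n+m-1$ columns whose rows are the coefficients of $\partial^{m-2}P,\dots,\partial P,P,\partial^{n-2}Q,\dots,\partial Q,Q$ with respect to $\partial^{n+m-2},\dots,\partial,1$ (there are no rows from $P$ if $m=1$, and none from $Q$ if $n=1$). For $j=0,1$, let $\phi_j(P,Q)$ be the determinant of the square matrix obtained from $S_1$ by removing the columns of $\partial$ and $1$ except for that of $\partial^j$. The first differential subresultant of $P$ and $Q$ is $\phi_0(P,Q)+\phi_1(P,Q)\,\partial$. Put $\phi_j^i=\phi_j(L-\lambda,A_i-\mu_i)\in\Sigma[\lambda,\mu_1,\mu_2]$ for $j=0,1$ and $i=1,2$. Then $\Sigma[\Gamma]$ is an integral domain, so that $\Sigma(\Gamma)$ is a differential field; $\phi_1^1$ and $\phi_1^2$ are nonzero in $\Sigma(\Gamma)$; the fractions $\phi_0^1/\phi_1^1$ and $\phi_0^2/\phi_1^2$ are equal in $\Sigma(\Gamma)$; and, with $\phi$ denoting their common value, the operator $\partial+\phi$ of order one is the monic greatest common right divisor in $\Sigma(\Gamma)[\partial]$ of $L-\lambda$, $A_1-\mu_1$ and $A_2-\mu_2$, and it is also the monic greatest common right divisor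 of $L-\lambda$ and $A_i-\mu_i$ for $i=1$ and for $i=2$. -/

import Mathlib

noncomputable section

/-! ### Differential rings: constants and extension of derivations -/

/-- The field of constants of a differential field. -/
def constants (F : Type*) [Field F] [Differential F] : Subfield F where
  carrier := {a | Differential.deriv a = 0}
  mul_mem' {a b} ha hb := by
    simp only [Set.mem_ofPred_eq] at *
    simp [Derivation.leibniz, ha, hb]
  one_mem' := by simp
  add_mem' {a b} ha hb := by
    simp only [Set.mem_ofPred_eq] at *
    simp [ha, hb]
  zero_mem' := by simp
  neg_mem' {a} ha := by
    simp only [Set.mem_ofPred_eq] at *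
    simp [ha]
  inv_mem' a ha := by
    simp only [Set.mem_ofPred_eq] at *
    simp [Derivation.leibniz_inv, ha]

section Extension

variable {R : Type*} [CommRing R] [Differential R]

/-- The coefficientwise additive map `∑ a_m x^m ↦ ∑ a_m' x^m` on multivariate polynomials. -/
def mvDerivAux (σ : Type*) : MvPolynomial σ R →+ MvPolynomial σ R where
  toFun p := ∑ m ∈ p.support, MvPolynomial.monomial m (Differential.deriv (p.coeff m))
  map_zero' := by simp
  map_add' p q := by
    classical
    ext n
    simp only [MvPolynomial.coeff_add, MvPolynomial.coeff_sum, MvPolynomial.coeff_monomial,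
      Finset.sum_ite_eq', MvPolynomial.mem_support_iff]
    by_cases hp : p.coeff n = 0 <;> by_cases hq : q.coeff n = 0 <;>
      by_cases hpq : p.coeff n + q.coeff n = 0 <;> simp_all [← map_add]

theorem mvDerivAux_monomial {σ : Type*} (m : σ →₀ ℕ) (a : R) :
    mvDerivAux σ (MvPolynomial.monomial m a) =
      MvPolynomial.monomial m (Differential.deriv a) := by
  classical
  ext n
  simp only [mvDerivAux, AddMonoidHom.coe_mk, ZeroHom.coe_mk, MvPolynomial.coeff_sum,
    MvPolynomial.coeff_monomial, Finset.sum_ite_eq', MvPolynomial.mem_support_iff]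
  by_cases h : m = n <;> by_cases ha : a = 0 <;> simp [h, ha]

/-- The derivation of `R` is extended to polynomial rings by declaring the variables constant. -/
instance mvDifferential {σ : Type*} : Differential (MvPolynomial σ R) where
  deriv := Derivation.mk' (mvDerivAux σ).toIntLinearMap (by
    intro p q
    simp only [AddMonoidHom.coe_toIntLinearMap, smul_eq_mul]
    induction p using MvPolynomial.induction_on' with
    | add p₁ p₂ h₁ h₂ => simp only [add_mul, map_add, h₁, h₂, mul_add]; ring
    | monomial m a =>
      induction q using MvPolynomial.induction_on' with
      | add q₁ q₂ h₁ h₂ => simp only [add_mul, map_add, h₁, h₂, mul_add]; ring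
      | monomial n b =>
        simp only [MvPolynomial.monomial_mul, mvDerivAux_monomial, Derivation.leibniz,
          smul_eq_mul, map_add]
        rw [add_comm n m])

theorem mvDeriv_monomial {σ : Type*} (m : σ →₀ ℕ) (a : R) :
    Differential.deriv (MvPolynomial.monomial m a) =
      MvPolynomial.monomial m (Differential.deriv a) :=
  mvDerivAux_monomial m a

section

variable (R) (K : Type*) [CommRing K] [Algebra R K]

/-- The ring homomorphism `r ↦ r + r' ε` from `R` to the dual numbers over its total ring of
fractions `K`. -/
def fracDerivHom : R →+* TrivSqZeroExt K K where
  toFun r := TrivSqZeroExt.inl (algebraMap R K r) +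
    TrivSqZeroExt.inr (algebraMap R K (Differential.deriv r))
  map_one' := by ext <;> simp
  map_zero' := by ext <;> simp
  map_add' a b := by ext <;> simp [-DualNumber.inr_eq_smul_eps]
  map_mul' a b := by
    ext
    · simp
    · simp [-DualNumber.inr_eq_smul_eps, Derivation.leibniz]
      ring

variable [IsFractionRing R K]

theorem fracDerivHom_isUnit (s : nonZeroDivisors R) : IsUnit (fracDerivHom R K s) := by
  rw [TrivSqZeroExt.isUnit_iff_isUnit_fst]
  simpa [fracDerivHom] using IsLocalization.map_units K s

/-- The extension of `fracDerivHom` to fractions. -/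
def fracDerivLift : K →+* TrivSqZeroExt K K :=
  IsLocalization.lift (M := nonZeroDivisors R) (g := fracDerivHom R K) (fracDerivHom_isUnit R K)

theorem fracDerivLift_fst (x : K) : (fracDerivLift R K x).fst = x := by
  have h : ((TrivSqZeroExt.fstHom K K K).toRingHom.comp (fracDerivLift R K)) =
      RingHom.id _ := by
    refine IsLocalization.ringHom_ext (nonZeroDivisors R) ?_
    ext r
    simp [fracDerivLift, fracDerivHom]
  exact DFunLike.congr_fun h x

/-- The derivation of `R` is extended to its total ring of fractions by the quotient rule. -/
def fracDeriv : Derivation ℤ K K :=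
  Derivation.mk'
    (AddMonoidHom.toIntLinearMap
      { toFun := fun x => (fracDerivLift R K x).snd
        map_zero' := by simp
        map_add' := by simp })
    (by
      intro a b
      simp [fracDerivLift_fst, mul_comm])

theorem fracDeriv_algebraMap (r : R) :
    fracDeriv R K (algebraMap R K r) = algebraMap R K (Differential.deriv r) := by
  change (fracDerivLift R K (algebraMap R K r)).snd = _
  simp [fracDerivLift, fracDerivHom, -DualNumber.inr_eq_smul_eps]

end

instance fracDifferential : Differential (FractionRing R) where
  deriv := fracDeriv R (FractionRing R)

end Extension

/-! ### The ring of linear differential operators -/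

/-- Linear differential operators `∑ a_i ∂^i` over a differential ring `R`; such an operator is
stored as the polynomial with coefficients `a_i` (written on the left). The multiplication is not
the one of polynomials: it is defined below. -/
def DiffOp (R : Type*) [CommRing R] : Type _ := Polynomial R

namespace DiffOp

section

variable {R : Type*} [CommRing R]

instance : AddCommGroup (DiffOp R) := inferInstanceAs (AddCommGroup (Polynomial R))

instance : Module R (DiffOp R) := inferInstanceAs (Module R (Polynomial R))

/-- The operator `∑ a_i ∂^i` with given coefficients. -/
def ofPoly (p : Polynomial R) : DiffOp R := p

/-- The polynomial formed by the coefficients. -/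
def toPoly (P : DiffOp R) : Polynomial R := P

/-- The coefficient of `∂^i`. -/
def coeff (P : DiffOp R) (i : ℕ) : R := P.toPoly.coeff i

/-- The order of an operator (`0` for the zero operator). -/
def order (P : DiffOp R) : ℕ := P.toPoly.natDegree

/-- The leading coefficient is `1`. -/
def Monic (P : DiffOp R) : Prop := P.toPoly.Monic

/-- The operator of multiplication by a function. -/
def mulOp (a : R) : DiffOp R := ofPoly (Polynomial.C a)

/-- The operator `∂`. -/
def del : DiffOp R := ofPoly Polynomial.X

/-- Apply a homomorphism of rings to the coefficients. -/
def map {S : Type*} [CommRing S] (f : R →+* S) (P : DiffOp R) : DiffOp S :=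
  ofPoly (P.toPoly.map f)

end

section

variable {R : Type*} [CommRing R] [Differential R]

/-- Left multiplication by `∂`: `∂ (∑ b_j ∂^j) = ∑ b_j ∂^(j+1) + ∑ b_j' ∂^j`. -/
def delMul (R : Type*) [CommRing R] [Differential R] : AddMonoid.End (Polynomial R) where
  toFun q := Polynomial.X * q + Differential.mapCoeffs q
  map_zero' := by simp
  map_add' p q := by simp [mul_add]; abel

/-- Left multiplication by `∑ a_i ∂^i`, as the additive map `∑ a_i (delMul)^i`. -/
def act : Polynomial R →+ AddMonoid.End (Polynomial R) :=
  Polynomial.eval₂AddMonoidHom (Module.toAddMonoidEnd R (Polynomial R)) (delMul R)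

theorem act_monomial (i : ℕ) (a : R) :
    act (Polynomial.monomial i a) =
      Module.toAddMonoidEnd R (Polynomial R) a * delMul R ^ i := by
  simp [act, Polynomial.eval₂_monomial]

theorem delMul_mul_smul (a : R) :
    delMul R * Module.toAddMonoidEnd R (Polynomial R) a =
      Module.toAddMonoidEnd R (Polynomial R) a * delMul R +
        Module.toAddMonoidEnd R (Polynomial R) (Differential.deriv a) := by
  ext1 q
  change Polynomial.X * (a • q) + Differential.mapCoeffs (a • q) =
    a • (Polynomial.X * q + Differential.mapCoeffs q) + Differential.deriv a • q
  rw [Polynomial.smul_eq_C_mul, Derivation.leibniz, Differential.mapCoeffs_C]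
  simp only [Polynomial.smul_eq_C_mul, smul_eq_mul]
  ring

theorem act_smul (a : R) (q : Polynomial R) :
    act (a • q) = Module.toAddMonoidEnd R (Polynomial R) a * act q := by
  induction q using Polynomial.induction_on' with
  | add p q hp hq => rw [smul_add, map_add, map_add, hp, hq, mul_add]
  | monomial j b =>
    rw [Polynomial.smul_monomial, act_monomial, act_monomial, smul_eq_mul, map_mul, mul_assoc]

theorem act_delMul (q : Polynomial R) : act (delMul R q) = delMul R * act q := by
  induction q using Polynomial.induction_on' with
  | add p q hp hq => rw [map_add, map_add, map_add, hp, hq, mul_add]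
  | monomial j b =>
    have h : delMul R (Polynomial.monomial j b) =
        Polynomial.monomial (j + 1) b + Polynomial.monomial j (Differential.deriv b) := by
      change Polynomial.X * _ + Differential.mapCoeffs _ = _
      rw [Polynomial.X_mul_monomial, Differential.mapCoeffs_monomial]
    rw [h, map_add, act_monomial, act_monomial, act_monomial, ← mul_assoc, delMul_mul_smul,
      add_mul, pow_succ', mul_assoc]

theorem act_act (p q : Polynomial R) : act (act p q) = act p * act q := by
  induction p using Polynomial.induction_on' with
  | add p₁ p₂ h₁ h₂ =>
    rw [map_add, add_mul, ← h₁, ← h₂]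
    exact map_add act (act p₁ q) (act p₂ q)
  | monomial i a =>
    rw [act_monomial, mul_assoc]
    change act (a • ((delMul R ^ i) q)) = _
    rw [act_smul]
    congr 1
    induction i with
    | zero => simp
    | succ i ih =>
      rw [pow_succ']
      change act (delMul R ((delMul R ^ i) q)) = _
      rw [act_delMul, ih, mul_assoc]

theorem act_one_apply (p : Polynomial R) : act p 1 = p := by
  induction p using Polynomial.induction_on' with
  | add p₁ p₂ h₁ h₂ =>
    rw [map_add]
    change act p₁ 1 + act p₂ 1 = _
    rw [h₁, h₂]
  | monomial i a =>
    have h : (delMul R ^ i) (1 : Polynomial R) = Polynomial.X ^ i := by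
      induction i with
      | zero => simp
      | succ i ih =>
        rw [pow_succ']
        change delMul R ((delMul R ^ i) 1) = _
        rw [ih]
        change Polynomial.X * Polynomial.X ^ i + Differential.mapCoeffs (Polynomial.X ^ i) = _
        rw [Derivation.leibniz_pow, Differential.mapCoeffs_X]
        simp [pow_succ']
    rw [act_monomial]
    change a • ((delMul R ^ i) (1 : Polynomial R)) = _
    rw [h, Polynomial.smul_X_eq_monomial]

/-- The ring `R[∂]`, with `∂ a = a ∂ + a'`. -/
instance : Ring (DiffOp R) :=
  { (inferInstance : AddCommGroup (DiffOp R)) with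
    mul := fun P Q => ofPoly (act P.toPoly Q.toPoly)
    one := ofPoly 1
    mul_assoc := fun P Q S => DFunLike.congr_fun (act_act P.toPoly Q.toPoly) S.toPoly
    one_mul := fun P => by
      change act (1 : Polynomial R) P.toPoly = P.toPoly
      rw [← Polynomial.monomial_zero_one, act_monomial]
      simp
    mul_one := fun P => act_one_apply P.toPoly
    left_distrib := fun P Q S => map_add (act P.toPoly) Q.toPoly S.toPoly
    right_distrib := fun P Q S => by
      change act (P.toPoly + Q.toPoly) S.toPoly = act P.toPoly S.toPoly + act Q.toPoly S.toPoly
      rw [map_add]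
      rfl
    zero_mul := fun P => by
      change act (0 : Polynomial R) P.toPoly = 0
      rw [map_zero]
      rfl
    mul_zero := fun P => map_zero (act P.toPoly) }

theorem smul_mul (a : R) (P Q : DiffOp R) : a • P * Q = a • (P * Q) :=
  DFunLike.congr_fun (act_smul a P.toPoly) Q.toPoly

theorem mul_smul_of_deriv_eq_zero (c : R) (hc : Differential.deriv c = 0) (P Q : DiffOp R) :
    P * (c • Q) = c • (P * Q) := by
  have hcomm : Commute (Module.toAddMonoidEnd R (Polynomial R) c) (delMul R) := by
    have h := delMul_mul_smul c
    rw [hc, map_zero, add_zero] at h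
    exact h.symm
  have key : ∀ p : Polynomial R,
      Commute (Module.toAddMonoidEnd R (Polynomial R) c) (act p) := by
    intro p
    induction p using Polynomial.induction_on' with
    | add p₁ p₂ h₁ h₂ => rw [map_add]; exact h₁.add_right h₂
    | monomial i a =>
      rw [act_monomial]
      refine Commute.mul_right ?_ (hcomm.pow_right i)
      rw [Commute, SemiconjBy, ← map_mul, ← map_mul, mul_comm]
  exact (DFunLike.congr_fun (key P.toPoly) Q.toPoly).symm

/-- `F[∂]` is an algebra over the field of constants of `F`. -/
instance {F : Type*} [Field F] [Differential F] : Algebra (constants F) (DiffOp F) :=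
  Algebra.ofModule
    (fun c P Q => smul_mul (c : F) P Q)
    (fun c P Q => mul_smul_of_deriv_eq_zero (c : F) c.2 P Q)

/-- `G` divides `P` on the right: `P = Q G` for some operator `Q`. -/
def RightDvd (G P : DiffOp R) : Prop := ∃ Q : DiffOp R, P = Q * G

/-- `G` is the monic greatest common right divisor of a set of operators. -/
structure IsMonicGcrd (S : Set (DiffOp R)) (G : DiffOp R) : Prop where
  monic : G.Monic
  rightDvd : ∀ P ∈ S, RightDvd G P
  greatest : ∀ H : DiffOp R, (∀ P ∈ S, RightDvd H P) → RightDvd H G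

/-- The rows of the matrix `S_k` of two operators `P`, `Q` of orders `n`, `m`: the operators
`∂^(m-1-k) P, …, ∂ P, P, ∂^(n-1-k) Q, …, ∂ Q, Q`, in this order. -/
def subresRow (P Q : DiffOp R) (k : ℕ) (r : ℕ) : DiffOp R :=
  if r < Q.order - k then del ^ (Q.order - k - 1 - r) * P
  else del ^ (P.order - k - 1 - (r - (Q.order - k))) * Q

/-- For operators `P`, `Q` of orders `n`, `m`, the square submatrix `S_k^i` of size `n + m - 2k`
of `S_k`: its columns are the coefficients of `∂^(n+m-k-1), …, ∂^(k+1)` and, in the last column,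
those of `∂^i`. -/
def subresMatrix (P Q : DiffOp R) (k i : ℕ) :
    Matrix (Fin ((Q.order - k) + (P.order - k))) (Fin ((Q.order - k) + (P.order - k))) R :=
  fun r c => (subresRow P Q k r).coeff
    (if (c : ℕ) + 1 = (Q.order - k) + (P.order - k) then i
      else P.order + Q.order - k - 1 - c)

/-- The coefficient of `∂^i` in the `k`-th differential subresultant of `P` and `Q`. -/
def subresCoeff (P Q : DiffOp R) (k i : ℕ) : R := (subresMatrix P Q k i).det

end

end DiffOp

/-! ### The spectral curve of the algebra generated by three operators -/

section Spectral

variable {F : Type*} [Field F] [Differential F]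

/-- The value `g(L, A₁, A₂)` of a polynomial `g(λ, μ₁, μ₂)` with constant coefficients. (The order
of the factors is irrelevant for commuting operators.) -/
def evalOps (L A₁ A₂ : DiffOp F) (g : MvPolynomial (Fin 3) (constants F)) : DiffOp F :=
  ∑ m ∈ g.support, g.coeff m • (L ^ m 0 * A₁ ^ m 1 * A₂ ^ m 2)

/-- The Burchnall-Chaundy polynomials of `L, A₁, A₂`; for commuting operators this is the kernel
of the ring homomorphism `λ ↦ L`, `μ₁ ↦ A₁`, `μ₂ ↦ A₂`. -/
def BC (L A₁ A₂ : DiffOp F) : Set (MvPolynomial (Fin 3) (constants F)) :=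
  {g | evalOps L A₁ A₂ g = 0}

/-- The ideal `[BC]` generated by the Burchnall-Chaundy polynomials in `F[λ, μ₁, μ₂]`. -/
def extBC (L A₁ A₂ : DiffOp F) : Ideal (MvPolynomial (Fin 3) F) :=
  Ideal.span (MvPolynomial.map (constants F).subtype '' BC L A₁ A₂)

/-- `[BC]` is a differential ideal. -/
theorem deriv_mem_extBC (L A₁ A₂ : DiffOp F) {p : MvPolynomial (Fin 3) F}
    (hp : p ∈ extBC L A₁ A₂) : Differential.deriv p ∈ extBC L A₁ A₂ := by
  induction hp using Submodule.span_induction with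
  | mem x hx =>
    obtain ⟨g, -, rfl⟩ := hx
    have h : Differential.deriv (MvPolynomial.map (constants F).subtype g) = 0 := by
      induction g using MvPolynomial.induction_on' with
      | add p q hp hq => rw [map_add, map_add, hp, hq, add_zero]
      | monomial m c =>
        rw [MvPolynomial.map_monomial, mvDeriv_monomial]
        have : Differential.deriv ((constants F).subtype c) = 0 := c.2
        rw [this, map_zero]
    rw [h]
    exact Ideal.zero_mem _
  | zero => rw [map_zero]; exact Ideal.zero_mem _
  | add x y _ _ hx hy => rw [map_add]; exact Ideal.add_mem _ hx hy
  | smul a x hx' hx =>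
    rw [smul_eq_mul, Derivation.leibniz]
    exact Ideal.add_mem _ (Ideal.mul_mem_left _ _ hx) (by
      rw [smul_eq_mul]; exact Ideal.mul_mem_right _ _ hx')

/-- The ring `F[Γ] = F[λ, μ₁, μ₂] / [BC]`. -/
abbrev SpectralRing (L A₁ A₂ : DiffOp F) : Type _ :=
  MvPolynomial (Fin 3) F ⧸ extBC L A₁ A₂

/-- The derivation `q + [BC] ↦ q' + [BC]` of `F[Γ]`. -/
instance spectralDifferential (L A₁ A₂ : DiffOp F) : Differential (SpectralRing L A₁ A₂) where
  deriv := Derivation.liftOfSurjective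
    (f := (Ideal.Quotient.mk (extBC L A₁ A₂)).toIntAlgHom)
    (d := Differential.deriv) Ideal.Quotient.mk_surjective (by
      intro x hx
      exact Ideal.Quotient.eq_zero_iff_mem.mpr
        (deriv_mem_extBC L A₁ A₂ (Ideal.Quotient.eq_zero_iff_mem.mp hx)))

theorem spectralDeriv_mk (L A₁ A₂ : DiffOp F) (p : MvPolynomial (Fin 3) F) :
    Differential.deriv (Ideal.Quotient.mk (extBC L A₁ A₂) p) =
      Ideal.Quotient.mk (extBC L A₁ A₂) (Differential.deriv p) :=
  Derivation.liftOfSurjective_apply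
    (f := (Ideal.Quotient.mk (extBC L A₁ A₂)).toIntAlgHom)
    (d := Differential.deriv) Ideal.Quotient.mk_surjective _ p

/-- The ring of fractions `F(Γ)` of `F[Γ]`; it is a field as soon as `F[Γ]` is a domain. -/
abbrev SpectralField (L A₁ A₂ : DiffOp F) : Type _ := FractionRing (SpectralRing L A₁ A₂)

/-- The canonical homomorphism `F[λ, μ₁, μ₂] → F(Γ)`. -/
def toSpectralField (L A₁ A₂ : DiffOp F) : MvPolynomial (Fin 3) F →+* SpectralField L A₁ A₂ :=
  (algebraMap (SpectralRing L A₁ A₂) (SpectralField L A₁ A₂)).comp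
    (Ideal.Quotient.mk (extBC L A₁ A₂))

/-- The operator `P - x_i` with coefficients in `F[λ, μ₁, μ₂]`, where `x₀ = λ`, `x₁ = μ₁`,
`x₂ = μ₂`. -/
def shifted (P : DiffOp F) (i : Fin 3) : DiffOp (MvPolynomial (Fin 3) F) :=
  P.map MvPolynomial.C - DiffOp.mulOp (MvPolynomial.X i)

end Spectral

end

noncomputable section

/-! ### Coefficients, orders and products of operators -/

namespace DiffOp

section Coeff

variable {R : Type*} [CommRing R]

/-! Let F[λ, μ₁, μ₂] act on F[∂], with F multiplying on the left and λ, μ₁, μ₂ multiplying on the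
right by L, A₁, A₂ (`IsPolyAct`). This needs A₁ and A₂ to commute. Some P = A₁ - q(L) has order
prime to 3, so 1, P, P² are independent over the polynomials in L. As the centralizer has three
generators over C[L], a nonzero polynomial in L times A₂ is a polynomial in L and P
(`commute_of_span_eq_centralizer`).

The map p ↦ p·1 has kernel exactly [BC], and this kernel is prime. Indeed, operators of equal order
commuting with L have leading coefficients proportional over C (`exists_constant_coeff_eq`), so
modulo lower order every p outside [BC] is a nonzero function times one polynomial with constant
coefficients. Leading terms then multiply without cancelling (`map_mul_one_ne_zero`).

As an F[Γ]-module, F[∂] has rank one: over F[λ] it is generated by 1, ∂, ∂², while 1, P, P² are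
independent (`exists_map_eq_map_one`). Hence every Q equals a fraction θ(Q) times 1, with θ(L) = λ
and θ(A_i) = μ_i. The rule θ(∂Q) = θ(Q)' + θ(∂)θ(Q) says that θ(Q) is the eigenvalue of Q on a
formal ψ with ψ' = θ(∂)ψ, so ∂ - θ(∂) divides every Q - θ(Q) on the right (`exists_rightDvd`).

It remains to see that no larger common divisor exists and that the subresultant finds this one. If
L - λ divides V(A_i - μ_i) on the right with V of order at most one, comparing remainders gives a
2×2 linear system whose determinant is monic quadratic in μ_i over F[λ], hence nonzero in F(Γ); so V
= 0 (`eq_zero_of_rightDvd_mul`). This makes φ₁ nonzero, and inverting the subresultant matrix writes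
∂ + φ as a left combination of the two operators (`isMonicGcrd_of_subres`). -/

@[ext]
theorem ext_coeff {P Q : DiffOp R} (h : ∀ k, P.coeff k = Q.coeff k) : P = Q :=
  Polynomial.ext h

theorem coeff_add (P Q : DiffOp R) (k : ℕ) : (P + Q).coeff k = P.coeff k + Q.coeff k :=
  Polynomial.coeff_add P.toPoly Q.toPoly k

theorem coeff_sub (P Q : DiffOp R) (k : ℕ) : (P - Q).coeff k = P.coeff k - Q.coeff k :=
  Polynomial.coeff_sub (R := R) P.toPoly Q.toPoly k

theorem coeff_neg (P : DiffOp R) (k : ℕ) : (-P).coeff k = -P.coeff k :=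
  Polynomial.coeff_neg (R := R) P.toPoly k

theorem coeff_smul (a : R) (P : DiffOp R) (k : ℕ) : (a • P).coeff k = a * P.coeff k :=
  Polynomial.coeff_smul a P.toPoly k

theorem coeff_zero (k : ℕ) : (0 : DiffOp R).coeff k = 0 :=
  Polynomial.coeff_zero k

theorem coeff_mulOp (a : R) (k : ℕ) : (mulOp a).coeff k = if k = 0 then a else 0 :=
  Polynomial.coeff_C

theorem coeff_map {S : Type*} [CommRing S] (f : R →+* S) (P : DiffOp R) (k : ℕ) :
    (P.map f).coeff k = f (P.coeff k) :=
  Polynomial.coeff_map f k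

/-- The operators all of whose coefficients of `∂^k`, `k ≥ n`, vanish. -/
def below (R : Type*) [CommRing R] (n : ℕ) : Submodule R (DiffOp R) where
  carrier := {P | ∀ k, n ≤ k → P.coeff k = 0}
  add_mem' hP hQ k hk := by rw [coeff_add, hP k hk, hQ k hk, add_zero]
  zero_mem' k _ := coeff_zero k
  smul_mem' a P hP k hk := by rw [coeff_smul, hP k hk, mul_zero]

theorem below_mono {m n : ℕ} (h : m ≤ n) : below R m ≤ below R n :=
  fun _ hP k hk => hP k (h.trans hk)

theorem mem_below_of_succ {n : ℕ} {P : DiffOp R} (hP : P ∈ below R (n + 1))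
    (h : P.coeff n = 0) : P ∈ below R n := fun k hk => by
  rcases hk.eq_or_lt with rfl | hk
  · exact h
  · exact hP k hk

theorem eq_zero_of_mem_below_zero {P : DiffOp R} (h : P ∈ below R 0) : P = 0 :=
  ext_coeff fun k => (h k (Nat.zero_le k)).trans (coeff_zero k).symm

theorem mem_below_order (P : DiffOp R) : P ∈ below R (P.order + 1) := fun _ hk =>
  Polynomial.coeff_eq_zero_of_natDegree_lt hk

theorem coeff_order_ne_zero {P : DiffOp R} (h : P ≠ 0) : P.coeff P.order ≠ 0 :=
  mt Polynomial.leadingCoeff_eq_zero.mp h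

theorem order_eq {P : DiffOp R} {n : ℕ} (h : P ∈ below R (n + 1)) (hn : P.coeff n ≠ 0) :
    P.order = n :=
  Polynomial.natDegree_eq_of_le_of_coeff_ne_zero
    (Polynomial.natDegree_le_iff_coeff_eq_zero.mpr fun k hk => h k hk) hn

theorem ne_zero_of_coeff {P : DiffOp R} {n : ℕ} (hn : P.coeff n ≠ 0) : P ≠ 0 := by
  rintro rfl
  exact hn (coeff_zero n)

theorem order_lt_of_mem_below {P : DiffOp R} {n : ℕ} (hP : P ≠ 0) (h : P ∈ below R n) :
    P.order < n := by
  by_contra hn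
  exact coeff_order_ne_zero hP (h _ (not_lt.mp hn))

theorem order_neg (P : DiffOp R) : (-P).order = P.order :=
  Polynomial.natDegree_neg P.toPoly

theorem order_zero : (0 : DiffOp R).order = 0 :=
  Polynomial.natDegree_zero

theorem mulOp_mem_below (a : R) : mulOp a ∈ below R 1 := fun k hk => by
  rw [coeff_mulOp, if_neg (by omega)]

end Coeff

/-! ### Leading coefficients of products. -/

section Mul

variable {R : Type*} [CommRing R] [Differential R]

instance : IsScalarTower R (DiffOp R) (DiffOp R) := ⟨fun a P Q => smul_mul a P Q⟩

theorem one_eq_mulOp : (1 : DiffOp R) = mulOp 1 := rfl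

theorem coeff_one (k : ℕ) : (1 : DiffOp R).coeff k = if k = 0 then 1 else 0 := by
  rw [one_eq_mulOp, coeff_mulOp]

theorem mulOp_eq_smul_one (a : R) : mulOp a = a • (1 : DiffOp R) := by
  ext k
  rw [coeff_mulOp, coeff_smul, coeff_one]
  split_ifs <;> simp

theorem del_mul_toPoly (P : DiffOp R) :
    (del * P).toPoly = Polynomial.X * P.toPoly + Differential.mapCoeffs P.toPoly := by
  change act Polynomial.X P.toPoly = _
  rw [← Polynomial.monomial_one_one_eq_X, act_monomial, Polynomial.monomial_one_one_eq_X,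
    map_one, one_mul, pow_one]
  rfl

theorem coeff_del_mul_zero (P : DiffOp R) :
    (del * P).coeff 0 = Differential.deriv (P.coeff 0) := by
  rw [coeff, del_mul_toPoly]
  simp [Differential.coeff_mapCoeffs, coeff]

theorem coeff_del_mul_succ (P : DiffOp R) (k : ℕ) :
    (del * P).coeff (k + 1) = P.coeff k + Differential.deriv (P.coeff (k + 1)) := by
  rw [coeff, del_mul_toPoly]
  simp [Differential.coeff_mapCoeffs, coeff]

theorem del_mul_smul (a : R) (P : DiffOp R) :
    del * (a • P) = a • (del * P) + Differential.deriv a • P := by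
  ext k
  cases k with
  | zero =>
    simp only [coeff_del_mul_zero, coeff_smul, coeff_add, Derivation.leibniz, smul_eq_mul]
    ring
  | succ k =>
    simp only [coeff_del_mul_succ, coeff_smul, coeff_add, Derivation.leibniz, smul_eq_mul]
    ring

theorem coeff_del_pow (i k : ℕ) : (del ^ i : DiffOp R).coeff k = if k = i then 1 else 0 := by
  induction i generalizing k with
  | zero => rw [pow_zero, coeff_one]
  | succ i ih =>
    rw [pow_succ']
    cases k with
    | zero =>
      rw [coeff_del_mul_zero, ih, if_neg i.succ_ne_zero.symm]
      split_ifs <;> simp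
    | succ k =>
      rw [coeff_del_mul_succ, ih, ih]
      split_ifs <;> simp_all

theorem coeff_del (k : ℕ) : (del : DiffOp R).coeff k = if k = 1 then 1 else 0 := by
  simpa using coeff_del_pow (R := R) 1 k

theorem eq_sum_of_mem_below {P : DiffOp R} {n : ℕ} (h : P ∈ below R n) :
    P = ∑ i ∈ Finset.range n, P.coeff i • (del ^ i : DiffOp R) := by
  have hsum : ∀ (s : Finset ℕ) (k : ℕ),
      (∑ i ∈ s, P.coeff i • (del ^ i : DiffOp R)).coeff k = if k ∈ s then P.coeff k else 0 := by
    intro s k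
    induction s using Finset.induction_on with
    | empty => simp [coeff_zero]
    | insert a s ha ih =>
      rw [Finset.sum_insert ha, coeff_add, ih, coeff_smul, coeff_del_pow]
      by_cases hk : k = a
      · subst hk; simp [ha]
      · simp [hk]
  ext k
  rw [hsum]
  split_ifs with hk
  · rfl
  · exact h k (by simpa using hk)

/-- Operators are generated from `1` by sums, multiples and left multiplication by `∂`. -/
theorem induction_on_del {motive : DiffOp R → Prop} (P : DiffOp R) (one : motive 1)
    (add : ∀ P Q, motive P → motive Q → motive (P + Q))
    (smul : ∀ (a : R) P, motive P → motive (a • P))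
    (del_mul : ∀ P, motive P → motive (del * P)) : motive P := by
  have hpow : ∀ i : ℕ, motive (del ^ i) := by
    intro i
    induction i with
    | zero => simpa using one
    | succ i ih => rw [pow_succ']; exact del_mul _ ih
  rw [eq_sum_of_mem_below (mem_below_order P)]
  refine Finset.sum_induction _ motive add ?_ fun i _ => smul _ _ (hpow i)
  simpa using smul 0 1 one

theorem del_mul_mem_below {n : ℕ} {P : DiffOp R} (h : P ∈ below R n) :
    del * P ∈ below R (n + 1) := by
  intro k hk
  obtain ⟨k, rfl⟩ : ∃ j, k = j + 1 := ⟨k - 1, by omega⟩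
  rw [coeff_del_mul_succ, h k (by omega), h (k + 1) (by omega)]
  simp

theorem del_pow_mul_mem_below {n : ℕ} {P : DiffOp R} (h : P ∈ below R n) (i : ℕ) :
    del ^ i * P ∈ below R (i + n) := by
  induction i with
  | zero => simpa using h
  | succ i ih =>
    rw [pow_succ', mul_assoc, show i + 1 + n = i + n + 1 by ring]
    exact del_mul_mem_below ih

theorem coeff_del_pow_mul {m : ℕ} {P : DiffOp R} (h : P ∈ below R (m + 1)) (i : ℕ) :
    (del ^ i * P).coeff (i + m) = P.coeff m := by
  induction i with
  | zero => simp
  | succ i ih =>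
    rw [pow_succ', mul_assoc, show i + 1 + m = i + m + 1 by ring, coeff_del_mul_succ, ih,
      del_pow_mul_mem_below h i (i + m + 1) (by omega)]
    simp

theorem coeff_del_pow_mul_pred {m : ℕ} {P : DiffOp R} (h : P ∈ below R (m + 2)) (i : ℕ) :
    (del ^ i * P).coeff (i + m) = P.coeff m + i * Differential.deriv (P.coeff (m + 1)) := by
  induction i with
  | zero => simp
  | succ i ih =>
    rw [pow_succ', mul_assoc, show i + 1 + m = i + m + 1 by ring, coeff_del_mul_succ, ih,
      add_assoc i m 1, coeff_del_pow_mul h]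
    push_cast
    ring

theorem mul_mem_below {m n : ℕ} {P Q : DiffOp R} (hP : P ∈ below R (n + 1))
    (hQ : Q ∈ below R m) : P * Q ∈ below R (n + m) := by
  rw [eq_sum_of_mem_below hP, Finset.sum_mul]
  refine Submodule.sum_mem _ fun i hi => ?_
  rw [smul_mul]
  exact Submodule.smul_mem _ _ (below_mono (by simp at hi; omega) (del_pow_mul_mem_below hQ i))

theorem below_succ_decomp {n : ℕ} {P : DiffOp R} (hP : P ∈ below R (n + 1)) :
    ∃ P' ∈ below R n, P = P.coeff n • del ^ n + P' := by
  refine ⟨P - P.coeff n • del ^ n, fun k hk => ?_, by abel⟩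
  rw [coeff_sub, coeff_smul, coeff_del_pow]
  rcases hk.eq_or_lt with rfl | hk
  · simp
  · simp [hP k hk, hk.ne']

theorem coeff_mul_top {m n : ℕ} {P Q : DiffOp R} (hP : P ∈ below R (n + 1))
    (hQ : Q ∈ below R (m + 1)) : (P * Q).coeff (n + m) = P.coeff n * Q.coeff m := by
  obtain ⟨P', hP', h⟩ := below_succ_decomp hP
  have h0 : (P' * Q).coeff (n + m) = 0 := by
    cases n with
    | zero => rw [eq_zero_of_mem_below_zero hP', zero_mul, coeff_zero]
    | succ n => exact mul_mem_below hP' hQ _ (by omega)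
  conv_lhs => rw [h]
  rw [add_mul, coeff_add, h0, smul_mul, coeff_smul, coeff_del_pow_mul hQ, add_zero]

/-- This is the highest coefficient that sees noncommutativity: moving ∂^(n+1) past b leaves (n+1)
b' ∂^n. Comparing it in the two products of commuting operators gives a differential equation for
leading coefficients. -/
theorem coeff_mul_top_pred {m n : ℕ} {P Q : DiffOp R} (hP : P ∈ below R (n + 2))
    (hQ : Q ∈ below R (m + 2)) :
    (P * Q).coeff (n + m + 1) = P.coeff (n + 1) * Q.coeff m + P.coeff n * Q.coeff (m + 1) +
      (n + 1) * (P.coeff (n + 1) * Differential.deriv (Q.coeff (m + 1))) := by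
  obtain ⟨P', hP', h⟩ := below_succ_decomp hP
  have h1 : P'.coeff n = P.coeff n := by
    conv_rhs => rw [h]
    simp [coeff_add, coeff_smul, coeff_del_pow]
  have h0 : (P' * Q).coeff (n + m + 1) = P.coeff n * Q.coeff (m + 1) := by
    rw [add_assoc, coeff_mul_top hP' hQ, h1]
  conv_lhs => rw [h]
  rw [add_mul, coeff_add, h0, smul_mul, coeff_smul, show n + m + 1 = (n + 1) + m by ring,
    coeff_del_pow_mul_pred hQ]
  push_cast
  ring

theorem order_one : (1 : DiffOp R).order = 0 :=
  Polynomial.natDegree_one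

variable [IsDomain R]

instance : NoZeroDivisors (DiffOp R) where
  eq_zero_or_eq_zero_of_mul_eq_zero {P Q} h := by
    by_contra! hne
    have h1 := coeff_mul_top (mem_below_order P) (mem_below_order Q)
    rw [h, coeff_zero] at h1
    exact mul_ne_zero (coeff_order_ne_zero hne.1) (coeff_order_ne_zero hne.2) h1.symm

instance : Nontrivial (DiffOp R) := inferInstanceAs (Nontrivial (Polynomial R))

theorem order_mul {P Q : DiffOp R} (hP : P ≠ 0) (hQ : Q ≠ 0) :
    (P * Q).order = P.order + Q.order := by
  have h1 := coeff_mul_top (mem_below_order P) (mem_below_order Q)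
  refine order_eq ?_ ?_
  · rw [add_assoc]; exact mul_mem_below (mem_below_order P) (mem_below_order Q)
  · rw [h1]; exact mul_ne_zero (coeff_order_ne_zero hP) (coeff_order_ne_zero hQ)

theorem order_pow {P : DiffOp R} (hP : P ≠ 0) (k : ℕ) : (P ^ k).order = k * P.order := by
  induction k with
  | zero => rw [pow_zero, order_one, zero_mul]
  | succ k ih => rw [pow_succ, order_mul (pow_ne_zero k hP) hP, ih]; ring

end Mul

/-! ### Change of coefficients along a differential homomorphism. -/

section Map

variable {R S : Type*} [CommRing R] [CommRing S]

protected theorem map_add (f : R →+* S) (P Q : DiffOp R) : (P + Q).map f = P.map f + Q.map f :=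
  Polynomial.map_add f

protected theorem map_sub (f : R →+* S) (P Q : DiffOp R) : (P - Q).map f = P.map f - Q.map f := by
  ext k; simp only [coeff_map, coeff_sub, map_sub]

protected theorem map_smul (f : R →+* S) (a : R) (P : DiffOp R) : (a • P).map f = f a • P.map f :=
  Polynomial.map_smul f a

theorem map_mulOp (f : R →+* S) (a : R) : (mulOp a).map f = mulOp (f a) :=
  Polynomial.map_C f

theorem map_map {T : Type*} [CommRing T] (g : S →+* T) (f : R →+* S) (P : DiffOp R) :
    (P.map f).map g = P.map (g.comp f) :=
  Polynomial.map_map f g P.toPoly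

variable [Differential R] [Differential S]

protected theorem map_one (f : R →+* S) : (1 : DiffOp R).map f = 1 :=
  Polynomial.map_one f

theorem map_del_mul (f : R →+* S)
    (hf : ∀ a, f (Differential.deriv a) = Differential.deriv (f a)) (P : DiffOp R) :
    (del * P).map f = del * P.map f := by
  ext k
  cases k with
  | zero => rw [coeff_map, coeff_del_mul_zero, coeff_del_mul_zero, hf, coeff_map]
  | succ k =>
    rw [coeff_map, coeff_del_mul_succ, coeff_del_mul_succ, map_add, hf, coeff_map, coeff_map]

protected theorem map_mul (f : R →+* S)
    (hf : ∀ a, f (Differential.deriv a) = Differential.deriv (f a)) (P Q : DiffOp R) :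
    (P * Q).map f = P.map f * Q.map f := by
  induction P using induction_on_del with
  | one => rw [one_mul, DiffOp.map_one, one_mul]
  | add P₁ P₂ h₁ h₂ => rw [add_mul, DiffOp.map_add, DiffOp.map_add, add_mul, h₁, h₂]
  | smul a P h => rw [smul_mul, DiffOp.map_smul, DiffOp.map_smul, smul_mul, h]
  | del_mul P h => rw [mul_assoc, map_del_mul f hf, map_del_mul f hf, mul_assoc, h]

theorem map_del_pow_mul (f : R →+* S)
    (hf : ∀ a, f (Differential.deriv a) = Differential.deriv (f a)) (i : ℕ) (P : DiffOp R) :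
    (del ^ i * P).map f = del ^ i * P.map f := by
  induction i with
  | zero => simp
  | succ i ih => rw [pow_succ', mul_assoc, map_del_mul f hf, ih, pow_succ', mul_assoc]

end Map

/-! ### Closure properties of right divisibility. -/

section RightDvd

variable {R : Type*} [CommRing R] [Differential R] {G P Q : DiffOp R}

theorem RightDvd.add (hP : RightDvd G P) (hQ : RightDvd G Q) : RightDvd G (P + Q) := by
  obtain ⟨A, rfl⟩ := hP
  obtain ⟨B, rfl⟩ := hQ
  exact ⟨A + B, (add_mul A B G).symm⟩

theorem RightDvd.mul_left (hP : RightDvd G P) (A : DiffOp R) : RightDvd G (A * P) := by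
  obtain ⟨B, rfl⟩ := hP
  exact ⟨A * B, (mul_assoc A B G).symm⟩

theorem RightDvd.smul (hP : RightDvd G P) (a : R) : RightDvd G (a • P) := by
  obtain ⟨B, rfl⟩ := hP
  exact ⟨a • B, (smul_mul a B G).symm⟩

theorem RightDvd.sub (hP : RightDvd G P) (hQ : RightDvd G Q) : RightDvd G (P - Q) := by
  obtain ⟨A, rfl⟩ := hP
  obtain ⟨B, rfl⟩ := hQ
  exact ⟨A - B, (sub_mul A B G).symm⟩

theorem RightDvd.zero : RightDvd G 0 := ⟨0, (zero_mul G).symm⟩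

theorem RightDvd.sum {ι : Type*} {s : Finset ι} {f : ι → DiffOp R}
    (h : ∀ i ∈ s, RightDvd G (f i)) : RightDvd G (∑ i ∈ s, f i) :=
  Finset.sum_induction f (RightDvd G) (fun _ _ => RightDvd.add) RightDvd.zero h

/-- An operator of order less than that of a right divisor is zero. -/
theorem RightDvd.eq_zero [IsDomain R] (h : RightDvd G P) (hP : P ∈ below R G.order) : P = 0 := by
  obtain ⟨A, rfl⟩ := h
  by_contra hne
  have h1 := order_lt_of_mem_below hne hP
  rw [order_mul (left_ne_zero_of_mul hne) (right_ne_zero_of_mul hne)] at h1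
  omega

end RightDvd

end DiffOp

/-! ### Operators commuting with a given operator -/

namespace DiffOp

/-! ### Independence by comparison of orders. -/

section Orders

variable {R : Type*} [CommRing R]

theorem order_add_eq {P Q : DiffOp R} (h : P.order ≠ Q.order) :
    (P + Q).order = P.order ∨ (P + Q).order = Q.order := by
  rcases lt_or_gt_of_ne h with h | h
  · exact Or.inr (Polynomial.natDegree_add_eq_right_of_natDegree_lt h)
  · exact Or.inl (Polynomial.natDegree_add_eq_left_of_natDegree_lt h)

theorem eq_zero_of_add_eq_zero {P Q : DiffOp R}
    (h : P ≠ 0 → Q ≠ 0 → P.order ≠ Q.order) (h0 : P + Q = 0) : P = 0 ∧ Q = 0 := by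
  have hQ : Q = -P := (neg_eq_of_add_eq_zero_right h0).symm
  subst hQ
  by_cases hP : P = 0
  · simp [hP]
  · exact absurd (order_neg P).symm (h hP (neg_ne_zero.mpr hP))

theorem eq_zero_of_add_add_eq_zero {P Q S : DiffOp R}
    (hPQ : P ≠ 0 → Q ≠ 0 → P.order ≠ Q.order) (hPS : P ≠ 0 → S ≠ 0 → P.order ≠ S.order)
    (hQS : Q ≠ 0 → S ≠ 0 → Q.order ≠ S.order) (h0 : P + Q + S = 0) :
    P = 0 ∧ Q = 0 ∧ S = 0 := by
  have hadd : P + Q ≠ 0 → S ≠ 0 → (P + Q).order ≠ S.order := by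
    intro h hS
    by_cases hP : P = 0
    · subst hP
      rw [zero_add] at h ⊢
      exact hQS h hS
    by_cases hQ : Q = 0
    · subst hQ
      rw [add_zero]
      exact hPS hP hS
    rcases order_add_eq (hPQ hP hQ) with h' | h' <;> rw [h']
    exacts [hPS hP hS, hQS hQ hS]
  obtain ⟨h1, h2⟩ := eq_zero_of_add_eq_zero hadd h0
  obtain ⟨h3, h4⟩ := eq_zero_of_add_eq_zero hPQ h1
  exact ⟨h3, h4, h2⟩

variable [Differential R]

/-- The action of `R[X]` on operators for which `X` acts by right multiplication by `L`. -/
def rightAct (L : DiffOp R) : Polynomial R →ₐ[R] Module.End R (DiffOp R) :=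
  Polynomial.aeval (LinearMap.mulRight R L)

theorem rightAct_C (L : DiffOp R) (a : R) (P : DiffOp R) :
    rightAct L (Polynomial.C a) P = a • P := by
  rw [rightAct, Polynomial.aeval_C]
  rfl

theorem rightAct_X (L P : DiffOp R) : rightAct L Polynomial.X P = P * L := by
  rw [rightAct, Polynomial.aeval_X]
  rfl

theorem rightAct_X_pow (L P : DiffOp R) (k : ℕ) :
    rightAct L (Polynomial.X ^ k) P = P * L ^ k := by
  induction k with
  | zero => simp
  | succ k ih =>
    rw [pow_succ', map_mul, Module.End.mul_apply, ih, rightAct_X, mul_assoc, pow_succ]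

variable [IsDomain R]

theorem rightAct_mem_below {L P : DiffOp R} (hL : L ≠ 0) (hP : P ≠ 0) (g : Polynomial R) {n : ℕ}
    (hn : ∀ k, g.coeff k ≠ 0 → P.order + k * L.order < n) : rightAct L g P ∈ below R n := by
  rw [g.as_sum_support_C_mul_X_pow, map_sum, LinearMap.sum_apply]
  refine Submodule.sum_mem _ fun k hk => ?_
  rw [map_mul, Module.End.mul_apply, rightAct_C, rightAct_X_pow]
  refine Submodule.smul_mem _ _ (below_mono ?_ (mem_below_order _))
  rw [order_mul hP (pow_ne_zero k hL), order_pow hL]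
  exact hn k (Polynomial.mem_support_iff.mp hk)

/-- Since L has positive order, the operators P L^k have distinct orders, so nothing cancels the
leading term of g. -/
theorem order_rightAct {L P : DiffOp R} (hL : 0 < L.order) (hP : P ≠ 0) {g : Polynomial R}
    (hg : g ≠ 0) : rightAct L g P ≠ 0 ∧
      (rightAct L g P).order = P.order + g.natDegree * L.order := by
  have hL0 : L ≠ 0 := by
    rintro rfl
    exact absurd hL (by simp [order_zero])
  set n := P.order + g.natDegree * L.order with hn
  have h1 : rightAct L g.eraseLead P ∈ below R n := by
    refine rightAct_mem_below hL0 hP _ fun k hk => ?_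
    have h2 : k < g.natDegree := by
      have h3 : k ∈ g.eraseLead.support := Polynomial.mem_support_iff.mpr hk
      exact Polynomial.lt_natDegree_of_mem_eraseLead_support h3
    have := Nat.mul_lt_mul_of_pos_right h2 hL
    omega
  have h2 : rightAct L g P = rightAct L g.eraseLead P +
      g.leadingCoeff • (P * L ^ g.natDegree) := by
    conv_lhs => rw [← g.eraseLead_add_C_mul_X_pow]
    rw [map_add, LinearMap.add_apply, map_mul, Module.End.mul_apply, rightAct_C, rightAct_X_pow]
  have hmul : P * L ^ g.natDegree ≠ 0 := mul_ne_zero hP (pow_ne_zero _ hL0)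
  have h3 : (P * L ^ g.natDegree).order = n := by
    rw [order_mul hP (pow_ne_zero _ hL0), order_pow hL0]
  have h4 : (rightAct L g P).coeff n ≠ 0 := by
    rw [h2, coeff_add, h1 n le_rfl, zero_add, coeff_smul, ← h3]
    exact mul_ne_zero (Polynomial.leadingCoeff_ne_zero.mpr hg) (coeff_order_ne_zero hmul)
  refine ⟨ne_zero_of_coeff h4, order_eq ?_ h4⟩
  rw [h2]
  refine Submodule.add_mem _ (below_mono n.le_succ h1) (Submodule.smul_mem _ _ ?_)
  rw [← h3]
  exact mem_below_order _

theorem rightAct_eq_zero_iff {L P : DiffOp R} (hL : 0 < L.order) (hP : P ≠ 0) {g : Polynomial R} :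
    rightAct L g P = 0 ↔ g = 0 := by
  refine ⟨fun h => ?_, fun h => by rw [h, map_zero]; rfl⟩
  by_contra hg
  exact (order_rightAct hL hP hg).1 h

/-- If `L` has order `3` and the order of `P` is not divisible by `3`, then `1, P, P²` are
independent over the polynomials in `L`. -/
theorem eq_zero_of_rightAct_add_eq_zero {L P : DiffOp R} (hL : L.order = 3) (hP : ¬ 3 ∣ P.order)
    {a b c : Polynomial R}
    (h : rightAct L a 1 + rightAct L b P + rightAct L c (P ^ 2) = 0) :
    a = 0 ∧ b = 0 ∧ c = 0 := by
  have hP0 : P ≠ 0 := by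
    rintro rfl
    exact hP (by simp [order_zero])
  have hL0 : 0 < L.order := by omega
  -- Nonzero summands have orders congruent to 0, ord P and 2 ord P modulo 3. These residues are
  -- distinct, so the leading terms cannot cancel.
  have ha : rightAct L a 1 ≠ 0 → (rightAct L a 1).order % 3 = 0 := by
    intro h
    rw [Ne, rightAct_eq_zero_iff hL0 one_ne_zero] at h
    rw [(order_rightAct hL0 one_ne_zero h).2, order_one, hL]
    omega
  have hb : rightAct L b P ≠ 0 → (rightAct L b P).order % 3 = P.order % 3 := by
    intro h
    rw [Ne, rightAct_eq_zero_iff hL0 hP0] at h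
    rw [(order_rightAct hL0 hP0 h).2, hL]
    omega
  have hc : rightAct L c (P ^ 2) ≠ 0 → (rightAct L c (P ^ 2)).order % 3 = 2 * P.order % 3 := by
    intro h
    rw [Ne, rightAct_eq_zero_iff hL0 (pow_ne_zero 2 hP0)] at h
    rw [(order_rightAct hL0 (pow_ne_zero 2 hP0) h).2, order_pow hP0, hL]
    omega
  obtain ⟨h1, h2, h3⟩ := eq_zero_of_add_add_eq_zero
    (fun hn hn' => by have := ha hn; have := hb hn'; omega)
    (fun hn hn' => by have := ha hn; have := hc hn'; omega)
    (fun hn hn' => by have := hb hn; have := hc hn'; omega) h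
  exact ⟨(rightAct_eq_zero_iff hL0 one_ne_zero).mp h1, (rightAct_eq_zero_iff hL0 hP0).mp h2,
    (rightAct_eq_zero_iff hL0 (pow_ne_zero 2 hP0)).mp h3⟩

end Orders

/-- Four vectors in the span of three are linearly dependent. -/
theorem exists_relation_of_span_three {R M : Type*} [CommRing R] [Nontrivial R] [AddCommGroup M]
    [Module R M] (w : Fin 3 → M) (v : Fin 4 → M)
    (h : ∀ i, ∃ a : Fin 3 → R, v i = ∑ j, a j • w j) :
    ∃ g : Fin 4 → R, g ≠ 0 ∧ ∑ i, g i • v i = 0 := by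
  classical
  by_contra! hcon
  have hli : LinearIndependent R v := by
    rw [Fintype.linearIndependent_iff]
    intro g hg i
    by_contra hi
    exact hcon g (fun h0 => hi (by rw [h0]; rfl)) hg
  have h1 := linearIndependent_le_span' v hli (Set.range w) (by
    rintro _ ⟨i, rfl⟩
    obtain ⟨a, ha⟩ := h i
    rw [ha]
    exact Submodule.sum_mem _ fun j _ =>
      Submodule.smul_mem _ _ (Submodule.subset_span ⟨j, rfl⟩))
  have h2 : Fintype.card (Set.range w) ≤ 3 := by
    simpa using Fintype.card_range_le w
  rw [Cardinal.mk_fin] at h1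
  have h3 : 4 ≤ Fintype.card (Set.range w) := by exact_mod_cast h1
  omega

/-! ### The centralizer of an operator, and F[∂] over the polynomials in L. -/

section Centralizer

variable {F : Type*} [Field F] [Differential F]

theorem constants_smul_def (c : constants F) (P : DiffOp F) : c • P = (c : F) • P := rfl

/-- Constants can be moved past P. This carries independence over F[X] to relations with
coefficients in C[L]. -/
theorem rightAct_map_constants (L P : DiffOp F) (p : Polynomial (constants F)) :
    rightAct L (p.map (constants F).subtype) P = P * Polynomial.aeval L p := by
  induction p using Polynomial.induction_on' with
  | add p q hp hq => simp only [Polynomial.map_add, map_add, LinearMap.add_apply, hp, hq, mul_add]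
  | monomial k c =>
    rw [Polynomial.map_monomial, ← Polynomial.C_mul_X_pow_eq_monomial, map_mul,
      Module.End.mul_apply, rightAct_C, rightAct_X_pow, Polynomial.aeval_monomial,
      ← Algebra.smul_def, mul_smul_comm]
    rfl

theorem commute_aeval_left {L Q : DiffOp F} (h : Commute L Q) (p : Polynomial (constants F)) :
    Commute (Polynomial.aeval L p) Q := by
  induction p using Polynomial.induction_on' with
  | add p q hp hq => rw [map_add]; exact hp.add_left hq
  | monomial k c =>
    rw [Polynomial.aeval_monomial]
    exact Commute.mul_left (Algebra.commutes c Q) (h.pow_left k)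

variable [CharZero F]

/-- Two operators of the same order that commute with `L` have proportional leading
coefficients, up to a constant. -/
theorem exists_constant_coeff_eq {L Z W : DiffOp F} (hL : 0 < L.order) (hZ : Commute L Z)
    (hW : Commute L W) {n : ℕ} (hZn : Z ∈ below F (n + 1)) (hWn : W ∈ below F (n + 1))
    (hW0 : W.coeff n ≠ 0) : ∃ c : constants F, Z.coeff n = c * W.coeff n := by
  obtain ⟨l, hl⟩ : ∃ l, L.order = l + 1 := ⟨L.order - 1, by omega⟩
  have hLl : L ∈ below F (l + 2) := by
    have := mem_below_order L
    rwa [hl] at this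
  have hL0 : L.coeff (l + 1) ≠ 0 := by
    rw [← hl]
    refine coeff_order_ne_zero ?_
    rintro rfl
    exact absurd hL (by simp [order_zero])
  -- Compare the next-to-leading coefficients of L(YL) and (YL)L. Replacing Y by YL ensures that
  -- such a coefficient exists even when n = 0.
  have key : ∀ Y : DiffOp F, Commute L Y → Y ∈ below F (n + 1) →
      ((l : F) + 1) * (L.coeff (l + 1) * Differential.deriv (Y.coeff n * L.coeff (l + 1))) =
        ((n + l : ℕ) + 1) * ((Y.coeff n * L.coeff (l + 1)) *
          Differential.deriv (L.coeff (l + 1))) := by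
    intro Y hY hYn
    have h1 : Y * L ∈ below F (n + l + 2) := by
      have := mul_mem_below hYn hLl
      rwa [← add_assoc] at this
    have h2 : Commute L (Y * L) := hY.mul_right (Commute.refl L)
    have h3 := coeff_mul_top_pred hLl h1
    have h4 := coeff_mul_top_pred h1 hLl
    rw [h2.eq, show l + (n + l) + 1 = n + l + l + 1 by ring, h4] at h3
    rw [show n + l + 1 = n + (l + 1) by ring, coeff_mul_top hYn hLl] at h3
    linear_combination -h3
  have hz := key Z hZ hZn
  have hw := key W hW hWn
  set z := Z.coeff n * L.coeff (l + 1)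
  set w := W.coeff n * L.coeff (l + 1) with hwdef
  have hw0 : w ≠ 0 := mul_ne_zero hW0 hL0
  have hl1 : (l : F) + 1 ≠ 0 := by exact_mod_cast l.succ_ne_zero
  -- Both z and w solve the same homogeneous linear equation of order one, so their quotient is
  -- constant. Characteristic zero allows cancelling l + 1.
  have hd : Differential.deriv z * w = z * Differential.deriv w := by
    apply mul_left_cancel₀ (mul_ne_zero hl1 hL0)
    linear_combination w * hz - z * hw
  have hc : Differential.deriv (Z.coeff n / W.coeff n) = 0 := by
    have : Z.coeff n / W.coeff n = z / w := (mul_div_mul_right _ _ hL0).symm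
    rw [this, Derivation.leibniz_div]
    simp only [smul_eq_mul]
    rw [mul_comm w, hd, sub_self, mul_zero]
  exact ⟨⟨_, hc⟩, (div_mul_cancel₀ _ hW0).symm⟩

/-- As long as the order is 3k, a constant multiple of L^k cancels the leading term. The descent
never reaches 0, since Z is not a polynomial in L. As the zero operator has order 0 by convention,
the conclusion includes that the difference is nonzero. -/
theorem exists_reduced {L : DiffOp F} (hL : L.order = 3) {Z : DiffOp F} (hZ : Commute L Z)
    (hZL : Z ∉ Algebra.adjoin (constants F) {L}) :
    ∃ p : Polynomial (constants F), ¬ 3 ∣ (Z - Polynomial.aeval L p).order := by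
  induction hn : Z.order using Nat.strong_induction_on generalizing Z with
  | _ n ih =>
    by_cases h3 : 3 ∣ n
    · obtain ⟨k, hk⟩ := h3
      have hL0 : L ≠ 0 := by
        rintro rfl
        simp [order_zero] at hL
      have hLk : (L ^ k).order = n := by rw [order_pow hL0, hL, hk, mul_comm]
      have h1 : L ^ k ∈ below F (n + 1) := by
        rw [← hLk]; exact mem_below_order _
      have h2 : Z ∈ below F (n + 1) := by
        rw [← hn]; exact mem_below_order _
      have h4 : (L ^ k).coeff n ≠ 0 := by
        rw [← hLk]; exact coeff_order_ne_zero (pow_ne_zero k hL0)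
      obtain ⟨c, hc⟩ := exists_constant_coeff_eq (by omega) hZ
        ((Commute.refl L).pow_right k) h2 h1 h4
      have h5 : Z - c • L ^ k ∈ below F n := by
        refine mem_below_of_succ (Submodule.sub_mem _ h2 (Submodule.smul_mem _ (c : F) h1)) ?_
        rw [coeff_sub, constants_smul_def, coeff_smul, hc, sub_self]
      have hmem : c • L ^ k ∈ Algebra.adjoin (constants F) {L} :=
        Subalgebra.smul_mem _ (Subalgebra.pow_mem _ (Algebra.self_mem_adjoin_singleton _ L) k) c
      have h6 : Z - c • L ^ k ∉ Algebra.adjoin (constants F) {L} := fun h =>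
        hZL (by simpa using Subalgebra.add_mem _ h hmem)
      have h7 : Z - c • L ^ k ≠ 0 := fun h => h6 (h ▸ Subalgebra.zero_mem _)
      obtain ⟨p, hp⟩ := ih _ (order_lt_of_mem_below h7 h5)
        (hZ.sub_right (((Commute.refl L).pow_right k).smul_right c)) h6 rfl
      refine ⟨p + Polynomial.monomial k c, ?_⟩
      rw [map_add, Polynomial.aeval_monomial, ← Algebra.smul_def]
      rwa [sub_sub, add_comm (c • L ^ k)] at hp
    · exact ⟨0, by rwa [map_zero, sub_zero, hn]⟩

/-- The centralizer of an operator of order `3` is commutative as soon as it is generated by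
`1, A₁, A₂` over the polynomials in `L`. -/
theorem commute_of_span_eq_centralizer {L A₁ A₂ : DiffOp F} (hL : L.order = 3)
    (hspan : (Submodule.span (Algebra.adjoin (constants F) {L}) {1, A₁, A₂} : Set (DiffOp F)) =
      Set.centralizer {L})
    (h₁ : Commute L A₁) (h₂ : Commute L A₂) (hA₁ : A₁ ∉ Algebra.adjoin (constants F) {L}) :
    Commute A₁ A₂ := by
  obtain ⟨p, hp⟩ := exists_reduced hL h₁ hA₁
  set P := A₁ - Polynomial.aeval L p with hPdef
  have hLp : Commute L (Polynomial.aeval L p) := (commute_aeval_left (Commute.refl L) p).symm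
  have hP : Commute L P := h₁.sub_right hLp
  suffices h : Commute P A₂ by
    have h' : A₁ = P + Polynomial.aeval L p := by rw [hPdef]; abel
    rw [h']
    exact h.add_left (commute_aeval_left h₂ p)
  -- X acts by left multiplication by L, so that linear algebra over a commutative ring applies.
  let _ : Module (Polynomial (constants F)) (DiffOp F) :=
    Module.compHom (DiffOp F) (Polynomial.aeval L : Polynomial (constants F) →ₐ[constants F]
      DiffOp F).toRingHom
  have hsmul : ∀ (q : Polynomial (constants F)) (Q : DiffOp F), q • Q = Polynomial.aeval L q * Q :=
    fun _ _ => rfl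
  have hgen : ∀ Z : DiffOp F, Commute L Z → ∃ a : Fin 3 → Polynomial (constants F),
      Z = ∑ j, a j • (![1, A₁, A₂] : Fin 3 → DiffOp F) j := by
    intro Z hZ
    have hmem : Z ∈ (Submodule.span (Algebra.adjoin (constants F) {L}) {1, A₁, A₂} :
        Set (DiffOp F)) := by
      rw [hspan, Set.mem_centralizer_iff]
      rintro _ rfl
      exact hZ
    have hadj : ∀ x : Algebra.adjoin (constants F) {L}, ∃ q : Polynomial (constants F),
        Polynomial.aeval L q = (x : DiffOp F) := fun x =>
      (Algebra.adjoin_singleton_eq_range_aeval (constants F) L).le x.2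
    obtain ⟨x, y, z, rfl⟩ := Submodule.mem_span_triple.mp hmem
    obtain ⟨a, ha⟩ := hadj x
    obtain ⟨b, hb⟩ := hadj y
    obtain ⟨c, hc⟩ := hadj z
    refine ⟨![a, b, c], ?_⟩
    simp only [Fin.sum_univ_three, Matrix.cons_val, hsmul, ha, hb, hc]
    rfl
  obtain ⟨g, hg0, hg⟩ := exists_relation_of_span_three (![1, A₁, A₂] : Fin 3 → DiffOp F)
    (![A₂, 1, P, P ^ 2] : Fin 4 → DiffOp F) (by
      intro i
      apply hgen
      fin_cases i
      exacts [h₂, Commute.one_right L, hP, hP.pow_right 2])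
  simp only [Fin.sum_univ_four, Matrix.cons_val, hsmul] at hg
  have hgi : ∀ q : Polynomial (constants F), Commute (Polynomial.aeval L q) P :=
    commute_aeval_left hP
  -- Otherwise the relation would involve only 1, P, P², which are independent.
  have h0 : g 0 ≠ 0 := by
    intro h0
    rw [h0, map_zero, zero_mul, zero_add, (commute_aeval_left (Commute.one_right L) _).eq,
      (hgi _).eq, ((hgi (g 3)).pow_right 2).eq, ← rightAct_map_constants,
      ← rightAct_map_constants, ← rightAct_map_constants] at hg
    obtain ⟨h1, h2, h3⟩ := eq_zero_of_rightAct_add_eq_zero hL hp hg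
    have hinj : ∀ {q : Polynomial (constants F)}, q.map (constants F).subtype = 0 ↔ q = 0 :=
      Polynomial.map_eq_zero_iff (constants F).subtype.injective
    refine hg0 (funext fun i => ?_)
    fin_cases i
    exacts [h0, hinj.mp h1, hinj.mp h2, hinj.mp h3]
  have hne : Polynomial.aeval L (g 0) ≠ 0 := by
    intro h
    rw [← one_mul (Polynomial.aeval L (g 0)), ← rightAct_map_constants,
      rightAct_eq_zero_iff (by omega) one_ne_zero, Polynomial.map_eq_zero_iff
        (constants F).subtype.injective] at h
    exact h0 h
  have hcomm : Commute P (Polynomial.aeval L (g 0) * A₂) := by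
    have : Polynomial.aeval L (g 0) * A₂ = -(Polynomial.aeval L (g 1) * 1 +
        Polynomial.aeval L (g 2) * P + Polynomial.aeval L (g 3) * P ^ 2) := by
      rw [eq_neg_iff_add_eq_zero, ← hg]
      abel
    rw [this]
    refine Commute.neg_right (((Commute.mul_right ?_ (Commute.one_right P)).add_right
      (Commute.mul_right ?_ (Commute.refl P))).add_right
      (Commute.mul_right ?_ ((Commute.refl P).pow_right 2)))
    exacts [(hgi _).symm, (hgi _).symm, (hgi _).symm]
  -- P commutes with g₀(L) A₂ and with g₀(L), and the latter can be cancelled because F[∂] has no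
  -- zero divisors.
  have h8 : Polynomial.aeval L (g 0) * (P * A₂ - A₂ * P) = 0 := by
    rw [mul_sub, ← mul_assoc, (hgi _).eq, mul_assoc, hcomm.eq, mul_assoc, sub_self]
  exact sub_eq_zero.mp ((mul_eq_zero.mp h8).resolve_left hne)

/-- Every operator is a combination of `1, ∂, ∂²` over the polynomials in an operator of order
three. -/
theorem exists_eq_sum_rightAct {L : DiffOp F} (hL : L.order = 3) (P : DiffOp F) :
    ∃ a : Fin 3 → Polynomial F, P = ∑ j, rightAct L (a j) (del ^ (j : ℕ)) := by
  have hL0 : L ≠ 0 := by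
    rintro rfl
    simp [order_zero] at hL
  suffices h : ∀ n, ∀ P ∈ below F n,
      ∃ a : Fin 3 → Polynomial F, P = ∑ j, rightAct L (a j) (del ^ (j : ℕ)) from
    h _ P (mem_below_order P)
  intro n
  induction n with
  | zero =>
    intro P hP
    exact ⟨0, by simp [eq_zero_of_mem_below_zero hP]⟩
  | succ n ih =>
    intro P hP
    let r : Fin 3 := ⟨n % 3, Nat.mod_lt _ (by norm_num)⟩
    -- This product has order exactly n, so a multiple of it removes the coefficient of ∂^n.
    set Q : DiffOp F := del ^ (r : ℕ) * L ^ (n / 3)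
    have hdel : (del ^ (r : ℕ) : DiffOp F).coeff r ≠ 0 := by simp [coeff_del_pow]
    have hr : (del ^ (r : ℕ) : DiffOp F).order = r := by
      refine order_eq (fun k hk => ?_) hdel
      rw [coeff_del_pow, if_neg (by omega)]
    have hQ : Q.order = n := by
      rw [order_mul (ne_zero_of_coeff hdel) (pow_ne_zero _ hL0), order_pow hL0, hL, hr]
      exact Nat.mod_add_div' n 3
    have hQ0 : Q.coeff n ≠ 0 := by
      rw [← hQ]
      exact coeff_order_ne_zero (mul_ne_zero (ne_zero_of_coeff hdel) (pow_ne_zero _ hL0))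
    have hQn : Q ∈ below F (n + 1) := by
      rw [← hQ]
      exact mem_below_order Q
    obtain ⟨a, ha⟩ := ih (P - (P.coeff n / Q.coeff n) • Q) (mem_below_of_succ
      (Submodule.sub_mem _ hP (Submodule.smul_mem _ _ hQn)) (by
        rw [coeff_sub, coeff_smul, div_mul_cancel₀ _ hQ0, sub_self]))
    refine ⟨a + Pi.single r
      (Polynomial.C (P.coeff n / Q.coeff n) * Polynomial.X ^ (n / 3)), ?_⟩
    have h1 : ∀ j : Fin 3, rightAct L ((Pi.single r (Polynomial.C (P.coeff n / Q.coeff n) *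
        Polynomial.X ^ (n / 3)) : Fin 3 → Polynomial F) j) (del ^ (j : ℕ)) =
        if j = r then (P.coeff n / Q.coeff n) • Q else 0 := by
      intro j
      by_cases hj : j = r
      · subst hj
        rw [Pi.single_eq_same, if_pos rfl, map_mul, Module.End.mul_apply, rightAct_C,
          rightAct_X_pow]
      · rw [Pi.single_eq_of_ne hj, if_neg hj, map_zero]
        rfl
    simp only [Pi.add_apply, map_add, LinearMap.add_apply, Finset.sum_add_distrib, ← ha, h1,
      Finset.sum_ite_eq', Finset.mem_univ, if_true]
    abel

end Centralizer

end DiffOp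

open DiffOp

/-! ### The action of `F[λ, μ₁, μ₂]` on operators -/

section

section Deriv

variable {R : Type*} [CommRing R] [Differential R] {σ : Type*}

theorem mvDeriv_C (a : R) : Differential.deriv (MvPolynomial.C a : MvPolynomial σ R) =
    MvPolynomial.C (Differential.deriv a) :=
  mvDeriv_monomial 0 a

theorem mvDeriv_X (i : σ) : Differential.deriv (MvPolynomial.X i : MvPolynomial σ R) = 0 := by
  rw [MvPolynomial.X, mvDeriv_monomial]
  simp

end Deriv

open scoped IsMulCommutative in
/-- Polynomials can be evaluated at pairwise commuting elements of a noncommutative algebra. -/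
theorem exists_algHom_X_eq {σ F E : Type*} [CommRing F] [Ring E] [Algebra F E] (e : σ → E)
    (h : ∀ i j, e i * e j = e j * e i) :
    ∃ Φ : MvPolynomial σ F →ₐ[F] E, ∀ i, Φ (MvPolynomial.X i) = e i := by
  have := Algebra.isMulCommutative_adjoin F (s := Set.range e) (by
    rintro _ ⟨i, rfl⟩ _ ⟨j, rfl⟩
    exact h i j)
  refine ⟨(Algebra.adjoin F (Set.range e)).val.comp (MvPolynomial.aeval fun i =>
    (⟨e i, Algebra.subset_adjoin ⟨i, rfl⟩⟩ : Algebra.adjoin F (Set.range e))), fun i => ?_⟩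
  simp

variable {F : Type*} [Field F] [Differential F] {L A₁ A₂ : DiffOp F}

/-- The variables `λ, μ₁, μ₂` act on operators by right multiplication by `L, A₁, A₂`. -/
def IsPolyAct (L A₁ A₂ : DiffOp F)
    (Φ : MvPolynomial (Fin 3) F →ₐ[F] Module.End F (DiffOp F)) : Prop :=
  ∀ i P, Φ (MvPolynomial.X i) P = P * (![L, A₁, A₂] : Fin 3 → DiffOp F) i

theorem exists_polyAct (h₁ : Commute L A₁) (h₂ : Commute L A₂) (h₁₂ : Commute A₁ A₂) :
    ∃ Φ : MvPolynomial (Fin 3) F →ₐ[F] Module.End F (DiffOp F),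
      IsPolyAct L A₁ A₂ Φ := by
  obtain ⟨Φ, hΦ⟩ := exists_algHom_X_eq (F := F) (E := Module.End F (DiffOp F))
    (fun i => LinearMap.mulRight F ((![L, A₁, A₂] : Fin 3 → DiffOp F) i)) (by
      have hc : ∀ i j, Commute ((![L, A₁, A₂] : Fin 3 → DiffOp F) i)
          ((![L, A₁, A₂] : Fin 3 → DiffOp F) j) := by
        intro i j
        fin_cases i <;> fin_cases j
        exacts [Commute.refl _, h₁, h₂, h₁.symm, Commute.refl _, h₁₂, h₂.symm, h₁₂.symm,
          Commute.refl _]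
      intro i j
      ext1 P
      simp only [Module.End.mul_apply, LinearMap.mulRight_apply, mul_assoc, (hc i j).eq])
  exact ⟨Φ, fun i P => by rw [hΦ]; rfl⟩

namespace IsPolyAct

variable {Φ : MvPolynomial (Fin 3) F →ₐ[F] Module.End F (DiffOp F)}

theorem map_C (a : F) (P : DiffOp F) : Φ (MvPolynomial.C a) P = a • P := by
  rw [← MvPolynomial.algebraMap_eq, AlgHom.commutes]
  rfl

theorem map_mul_apply (p q : MvPolynomial (Fin 3) F) (P : DiffOp F) :
    Φ (p * q) P = Φ p (Φ q P) := by
  rw [map_mul, Module.End.mul_apply]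

theorem map_comm_apply (p q : MvPolynomial (Fin 3) F) (P : DiffOp F) :
    Φ p (Φ q P) = Φ q (Φ p P) := by
  rw [← map_mul_apply, mul_comm, map_mul_apply]

theorem map_X_pow (hΦ : IsPolyAct L A₁ A₂ Φ) (i : Fin 3) (k : ℕ) (P : DiffOp F) :
    Φ (MvPolynomial.X i ^ k) P = P * (![L, A₁, A₂] : Fin 3 → DiffOp F) i ^ k := by
  induction k with
  | zero => simp
  | succ k ih => rw [pow_succ', map_mul_apply, ih, hΦ, mul_assoc, pow_succ]

theorem map_monomial (hΦ : IsPolyAct L A₁ A₂ Φ) (m : Fin 3 →₀ ℕ) (a : F) (P : DiffOp F) :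
    Φ (MvPolynomial.monomial m a) P = a • (P * (L ^ m 0 * A₁ ^ m 1 * A₂ ^ m 2)) := by
  have h : MvPolynomial.monomial m a = MvPolynomial.C a * (MvPolynomial.X 2 ^ m 2 *
      (MvPolynomial.X 1 ^ m 1 * MvPolynomial.X 0 ^ m 0)) := by
    rw [MvPolynomial.monomial_eq, Finsupp.prod_fintype _ _ (fun _ => pow_zero _),
      Fin.prod_univ_three]
    ring
  rw [h, map_mul_apply, map_C, map_mul_apply, map_mul_apply, map_X_pow hΦ, map_X_pow hΦ,
    map_X_pow hΦ]
  simp only [Matrix.cons_val, mul_assoc]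

theorem map_map_constants (hΦ : IsPolyAct L A₁ A₂ Φ)
    (g : MvPolynomial (Fin 3) (constants F)) (P : DiffOp F) :
    Φ (MvPolynomial.map (constants F).subtype g) P = P * evalOps L A₁ A₂ g := by
  conv_lhs => rw [g.as_sum]
  rw [map_sum, map_sum, LinearMap.sum_apply, evalOps, Finset.mul_sum]
  refine Finset.sum_congr rfl fun m _ => ?_
  rw [MvPolynomial.map_monomial, map_monomial hΦ, mul_smul_comm]
  rfl

theorem map_one_eq_evalOps (hΦ : IsPolyAct L A₁ A₂ Φ)
    (g : MvPolynomial (Fin 3) (constants F)) :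
    Φ (MvPolynomial.map (constants F).subtype g) 1 = evalOps L A₁ A₂ g := by
  rw [map_map_constants hΦ, one_mul]

/-- The factors come out reversed because right multiplications compose in the opposite order. -/
theorem evalOps_mul (hΦ : IsPolyAct L A₁ A₂ Φ) (g h : MvPolynomial (Fin 3) (constants F)) :
    evalOps L A₁ A₂ (g * h) = evalOps L A₁ A₂ h * evalOps L A₁ A₂ g := by
  rw [← map_one_eq_evalOps hΦ, map_mul, map_mul_apply, map_one_eq_evalOps hΦ,
    map_map_constants hΦ]

/-- Evaluate λg = gλ in both orders. -/
theorem commute_evalOps (hΦ : IsPolyAct L A₁ A₂ Φ) (g : MvPolynomial (Fin 3) (constants F)) :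
    Commute L (evalOps L A₁ A₂ g) := by
  have hX : evalOps L A₁ A₂ (MvPolynomial.X 0) = L := by
    rw [← map_one_eq_evalOps hΦ, MvPolynomial.map_X, hΦ, one_mul]
    rfl
  have h := evalOps_mul hΦ g (MvPolynomial.X 0)
  rw [mul_comm g, evalOps_mul hΦ, hX] at h
  exact h.symm

theorem map_eq_zero_of_mem (hΦ : IsPolyAct L A₁ A₂ Φ) {p : MvPolynomial (Fin 3) F}
    (hp : p ∈ extBC L A₁ A₂) : Φ p = 0 := by
  have h : extBC L A₁ A₂ ≤ RingHom.ker Φ := by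
    refine Ideal.span_le.mpr ?_
    rintro _ ⟨g, hg, rfl⟩
    refine LinearMap.ext fun P => ?_
    change Φ (MvPolynomial.map (constants F).subtype g) P = _
    rw [map_map_constants hΦ, show evalOps L A₁ A₂ g = 0 from hg, mul_zero]
    rfl
  exact h hp

/-- The Leibniz rule for the action. -/
theorem del_mul_map (hΦ : IsPolyAct L A₁ A₂ Φ) (p : MvPolynomial (Fin 3) F) (P : DiffOp F) :
    del * Φ p P = Φ (Differential.deriv p) P + Φ p (del * P) := by
  induction p using MvPolynomial.induction_on generalizing P with
  | C a => rw [mvDeriv_C, map_C, map_C, map_C, del_mul_smul, add_comm]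
  | add p q hp hq =>
    simp only [map_add, LinearMap.add_apply, mul_add, hp, hq]
    abel
  | mul_X p i hp =>
    rw [Derivation.leibniz, mvDeriv_X, smul_zero, zero_add, smul_eq_mul, mul_comm _ (Differential.deriv p),
      map_mul_apply, map_mul_apply, map_mul_apply, hp, hΦ, hΦ, mul_assoc]

/-! ### The order filtration -/

end IsPolyAct

/-- The span of the polynomials with constant coefficients whose value at `L, A₁, A₂` has order
less than `n`. -/
def evalBelow (L A₁ A₂ : DiffOp F) (n : ℕ) : Submodule F (MvPolynomial (Fin 3) F) :=
  Submodule.span F (MvPolynomial.map (constants F).subtype '' {g | evalOps L A₁ A₂ g ∈ below F n})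

theorem evalBelow_mono {m n : ℕ} (h : m ≤ n) : evalBelow L A₁ A₂ m ≤ evalBelow L A₁ A₂ n :=
  Submodule.span_mono (Set.image_mono fun _ hg => below_mono h hg)

theorem exists_mem_evalBelow (p : MvPolynomial (Fin 3) F) : ∃ n, p ∈ evalBelow L A₁ A₂ n := by
  induction p using MvPolynomial.induction_on' with
  | monomial m a =>
    refine ⟨(evalOps L A₁ A₂ (MvPolynomial.monomial m 1)).order + 1, ?_⟩
    have h : MvPolynomial.monomial m a =
        a • MvPolynomial.map (constants F).subtype (MvPolynomial.monomial m 1) := by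
      rw [MvPolynomial.map_monomial, map_one, MvPolynomial.smul_monomial, smul_eq_mul, mul_one]
    rw [h]
    exact Submodule.smul_mem _ _ (Submodule.subset_span ⟨_, mem_below_order _, rfl⟩)
  | add p q hp hq =>
    obtain ⟨m, hm⟩ := hp
    obtain ⟨n, hn⟩ := hq
    exact ⟨max m n, Submodule.add_mem _ (evalBelow_mono (le_max_left m n) hm)
      (evalBelow_mono (le_max_right m n) hn)⟩

/-- Only the zero operator lies in `below F 0`, so the generators of the bottom level are
Burchnall-Chaundy polynomials. -/
theorem evalBelow_zero_le {p : MvPolynomial (Fin 3) F} (hp : p ∈ evalBelow L A₁ A₂ 0) :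
    p ∈ extBC L A₁ A₂ := by
  have h : evalBelow L A₁ A₂ 0 ≤ (extBC L A₁ A₂).restrictScalars F := by
    refine Submodule.span_le.mpr ?_
    rintro _ ⟨g, hg, rfl⟩
    exact Ideal.subset_span ⟨g, eq_zero_of_mem_below_zero hg, rfl⟩
  exact h hp

namespace IsPolyAct

variable {Φ : MvPolynomial (Fin 3) F →ₐ[F] Module.End F (DiffOp F)}

/-- The filtration is compatible with products: order at most n for q and less than m for p gives
order less than n + m. -/
theorem map_mul_mem_below (hΦ : IsPolyAct L A₁ A₂ Φ) {m n : ℕ} {p q : MvPolynomial (Fin 3) F}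
    (hp : p ∈ evalBelow L A₁ A₂ m) (hq : q ∈ evalBelow L A₁ A₂ (n + 1)) :
    Φ (p * q) 1 ∈ below F (n + m) := by
  induction hp using Submodule.span_induction with
  | zero => rw [zero_mul, map_zero]; exact Submodule.zero_mem _
  | add x y _ _ hx hy => rw [add_mul, map_add]; exact Submodule.add_mem _ hx hy
  | smul a x _ hx =>
    rw [Algebra.smul_mul_assoc, map_smul]
    exact Submodule.smul_mem _ _ hx
  | mem x hx =>
    obtain ⟨g, hg, rfl⟩ := hx
    rw [map_mul_apply, map_map_constants hΦ]
    refine mul_mem_below ?_ hg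
    induction hq using Submodule.span_induction with
    | zero => rw [map_zero]; exact Submodule.zero_mem _
    | add x y _ _ hx hy => rw [map_add]; exact Submodule.add_mem _ hx hy
    | smul a x _ hx => rw [map_smul]; exact Submodule.smul_mem _ _ hx
    | mem x hx =>
      obtain ⟨g, hg, rfl⟩ := hx
      rw [map_one_eq_evalOps hΦ]
      exact hg

theorem map_aeval_X_zero (hΦ : IsPolyAct L A₁ A₂ Φ) (g : Polynomial F) (P : DiffOp F) :
    Φ (Polynomial.aeval (MvPolynomial.X 0) g) P = rightAct L g P := by
  have h : Φ (MvPolynomial.X 0) = LinearMap.mulRight F L := LinearMap.ext fun Q => hΦ 0 Q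
  rw [← Polynomial.aeval_algHom_apply, rightAct, h]

variable [CharZero F]

/-- Each step of the filtration has dimension at most one over F, because values of equal order have
leading coefficients proportional over the constants. Descending from a level that contains p must
stop at a nonzero leading term, since the bottom level lies in [BC]. -/
theorem exists_leading_term (hΦ : IsPolyAct L A₁ A₂ Φ) (hL : 0 < L.order)
    {p : MvPolynomial (Fin 3) F} (hp : p ∉ extBC L A₁ A₂) :
    ∃ (n : ℕ) (f : F) (g : MvPolynomial (Fin 3) (constants F)) (w : MvPolynomial (Fin 3) F),
      f ≠ 0 ∧ evalOps L A₁ A₂ g ∈ below F (n + 1) ∧ (evalOps L A₁ A₂ g).coeff n ≠ 0 ∧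
        w ∈ evalBelow L A₁ A₂ n ∧
          p = f • MvPolynomial.map (constants F).subtype g + w := by
  obtain ⟨n, hn⟩ := exists_mem_evalBelow (L := L) (A₁ := A₁) (A₂ := A₂) p
  induction n with
  | zero => exact absurd (evalBelow_zero_le hn) hp
  | succ n ih =>
    by_cases h : ∃ g, evalOps L A₁ A₂ g ∈ below F (n + 1) ∧ (evalOps L A₁ A₂ g).coeff n ≠ 0
    · obtain ⟨g, hg, hgn⟩ := h
      have hle : evalBelow L A₁ A₂ (n + 1) ≤
          Submodule.span F {MvPolynomial.map (constants F).subtype g} ⊔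
            evalBelow L A₁ A₂ n := by
        refine Submodule.span_le.mpr ?_
        rintro _ ⟨e, he, rfl⟩
        obtain ⟨c, hc⟩ := exists_constant_coeff_eq hL (commute_evalOps hΦ e)
          (commute_evalOps hΦ g) he hg hgn
        have heval : evalOps L A₁ A₂ (e - MvPolynomial.C c * g) =
            evalOps L A₁ A₂ e - (c : F) • evalOps L A₁ A₂ g := by
          rw [← map_one_eq_evalOps hΦ, map_sub, map_sub, map_mul, MvPolynomial.map_C,
            LinearMap.sub_apply, map_mul_apply, map_C, map_one_eq_evalOps hΦ,
            map_one_eq_evalOps hΦ]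
          rfl
        refine Submodule.mem_sup.mpr ⟨(c : F) • MvPolynomial.map (constants F).subtype g,
          Submodule.smul_mem _ _ (Submodule.mem_span_singleton_self _),
          MvPolynomial.map (constants F).subtype (e - MvPolynomial.C c * g),
          Submodule.subset_span ⟨_, ?_, rfl⟩, ?_⟩
        · refine mem_below_of_succ ?_ ?_
          · rw [heval]
            exact Submodule.sub_mem _ he (Submodule.smul_mem _ _ hg)
          · rw [heval, coeff_sub, coeff_smul, hc, sub_self]
        · rw [map_sub, map_mul, MvPolynomial.map_C, MvPolynomial.smul_eq_C_mul]
          exact add_sub_cancel _ _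
      obtain ⟨y, hy, w, hw, hyw⟩ := Submodule.mem_sup.mp (hle hn)
      obtain ⟨f, rfl⟩ := Submodule.mem_span_singleton.mp hy
      by_cases hf : f = 0
      · rw [hf, zero_smul, zero_add] at hyw
        exact ih (hyw ▸ hw)
      · exact ⟨n, f, g, w, hf, hg, hgn, hw, hyw.symm⟩
    -- No value has order exactly n, so the two consecutive levels coincide.
    · push Not at h
      have hsub : {g | evalOps L A₁ A₂ g ∈ below F (n + 1)} ⊆
          {g | evalOps L A₁ A₂ g ∈ below F n} := by
        intro e he
        exact mem_below_of_succ he (h e he)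
      exact ih (Submodule.span_mono (Set.image_mono hsub) hn)

/-- The coefficient of ∂^(m+n) is the product of the leading data of p and q. With q = 1 this yields
the kernel of p ↦ p·1, and in general it yields primality. -/
theorem map_mul_one_ne_zero (hΦ : IsPolyAct L A₁ A₂ Φ) (hL : 0 < L.order)
    {p q : MvPolynomial (Fin 3) F} (hp : p ∉ extBC L A₁ A₂) (hq : q ∉ extBC L A₁ A₂) :
    Φ (p * q) 1 ≠ 0 := by
  obtain ⟨m, a, g, v, ha, hg, hgm, hv, rfl⟩ := exists_leading_term hΦ hL hp
  obtain ⟨n, b, e, w, hb, he, hen, hw, rfl⟩ := exists_leading_term hΦ hL hq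
  have hmem : ∀ {k : ℕ} {f : MvPolynomial (Fin 3) (constants F)} (c : F),
      evalOps L A₁ A₂ f ∈ below F k →
        c • MvPolynomial.map (constants F).subtype f ∈ evalBelow L A₁ A₂ k := fun c hf =>
    Submodule.smul_mem _ c (Submodule.subset_span ⟨_, hf, rfl⟩)
  set G := MvPolynomial.map (constants F).subtype g
  set E := MvPolynomial.map (constants F).subtype e
  have h1 := map_mul_mem_below hΦ hw (hmem a hg) (m + n) le_rfl
  have h2 := map_mul_mem_below hΦ hv (Submodule.add_mem _ (hmem b he)
    (evalBelow_mono n.le_succ hw)) (m + n) (by omega)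
  have h3 : (Φ (a • G * b • E) 1).coeff (m + n) =
      (a * b) * ((evalOps L A₁ A₂ e).coeff n * (evalOps L A₁ A₂ g).coeff m) := by
    rw [Algebra.smul_mul_assoc, mul_smul_comm, smul_smul, ← map_mul, map_smul,
      LinearMap.smul_apply, map_one_eq_evalOps hΦ, evalOps_mul hΦ, coeff_smul, add_comm m n,
      coeff_mul_top he hg]
  have h4 : (a • G + v) * (b • E + w) = a • G * b • E + w * (a • G) + v * (b • E + w) := by ring
  refine ne_zero_of_coeff (n := m + n) ?_
  rw [h4, map_add, map_add, LinearMap.add_apply, LinearMap.add_apply, coeff_add, coeff_add, h1,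
    h2, h3, add_zero, add_zero]
  exact mul_ne_zero (mul_ne_zero ha hb) (mul_ne_zero hen hgm)

theorem mem_extBC_iff (hΦ : IsPolyAct L A₁ A₂ Φ) (hL : 0 < L.order)
    {p : MvPolynomial (Fin 3) F} : p ∈ extBC L A₁ A₂ ↔ Φ p 1 = 0 := by
  refine ⟨fun h => by rw [map_eq_zero_of_mem hΦ h]; rfl, fun h => ?_⟩
  by_contra hp
  by_cases h1 : (1 : MvPolynomial (Fin 3) F) ∈ extBC L A₁ A₂
  · exact hp ((Ideal.eq_top_iff_one _).mpr h1 ▸ Submodule.mem_top)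
  · exact map_mul_one_ne_zero hΦ hL hp h1 (by rwa [mul_one])

/-- The ideal generated by the Burchnall-Chaundy polynomials is prime. -/
theorem isPrime_extBC (hΦ : IsPolyAct L A₁ A₂ Φ) (hL : 0 < L.order) :
    (extBC L A₁ A₂).IsPrime := by
  refine Ideal.isPrime_iff.mpr ⟨fun h => ?_, fun {p q} hpq => ?_⟩
  · have h1 := (mem_extBC_iff hΦ hL).mp ((Ideal.eq_top_iff_one _).mp h)
    rw [map_one Φ, Module.End.one_apply] at h1
    exact one_ne_zero h1
  · by_contra! h
    exact map_mul_one_ne_zero hΦ hL h.1 h.2 ((mem_extBC_iff hΦ hL).mp hpq)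

end IsPolyAct

end

section

variable {F : Type*} [Field F] [Differential F] {L A₁ A₂ : DiffOp F}
  {Φ : MvPolynomial (Fin 3) F →ₐ[F] Module.End F (DiffOp F)}

/-- A field of functions on the spectral curve. -/
structure IsSpectralHom {K : Type*} [Field K] [Differential K] (L A₁ A₂ : DiffOp F)
    (ι : MvPolynomial (Fin 3) F →+* K) : Prop where
  eq_zero_iff : ∀ p, ι p = 0 ↔ p ∈ extBC L A₁ A₂
  map_deriv : ∀ p, ι (Differential.deriv p) = Differential.deriv (ι p)

namespace IsSpectralHom

variable {K : Type*} [Field K] [Differential K] {ι : MvPolynomial (Fin 3) F →+* K}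

theorem map_C_deriv (hι : IsSpectralHom L A₁ A₂ ι) (a : F) :
    ι (MvPolynomial.C (Differential.deriv a)) = Differential.deriv (ι (MvPolynomial.C a)) := by
  rw [← mvDeriv_C, hι.map_deriv]

theorem deriv_map_X (hι : IsSpectralHom L A₁ A₂ ι) (i : Fin 3) :
    Differential.deriv (ι (MvPolynomial.X i)) = 0 := by
  rw [← hι.map_deriv, mvDeriv_X, map_zero]

end IsSpectralHom

variable [CharZero F]

/-! ### Relations over the polynomials in `λ` -/

namespace IsPolyAct

/-- Every operator is, up to a nonzero multiple, the value of a polynomial. -/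
theorem exists_map_eq_map_one (hΦ : IsPolyAct L A₁ A₂ Φ) (hL : L.order = 3)
    (h₁ : Commute L A₁) (hA₁ : A₁ ∉ Algebra.adjoin (constants F) {L}) (Q : DiffOp F) :
    ∃ p c : MvPolynomial (Fin 3) F, p ∉ extBC L A₁ A₂ ∧ Φ p Q = Φ c 1 := by
  obtain ⟨q, hq⟩ := exists_reduced hL h₁ hA₁
  set P := A₁ - Polynomial.aeval L q with hP
  let _ : Module (Polynomial F) (DiffOp F) :=
    Module.compHom (DiffOp F) (rightAct L).toRingHom
  have hsmul : ∀ (g : Polynomial F) (Y : DiffOp F), g • Y = rightAct L g Y := fun _ _ => rfl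
  -- Over F[X] acting through L, the three elements 1, ∂, ∂² generate all operators, so Q, 1, P, P²
  -- are dependent.
  obtain ⟨g, hg0, hg⟩ := exists_relation_of_span_three
    (fun j : Fin 3 => (del ^ (j : ℕ) : DiffOp F)) (![Q, 1, P, P ^ 2] : Fin 4 → DiffOp F)
    (fun i => exists_eq_sum_rightAct hL _)
  simp only [Fin.sum_univ_four, Matrix.cons_val, hsmul] at hg
  have h0 : g 0 ≠ 0 := by
    intro h0
    rw [h0, map_zero, LinearMap.zero_apply, zero_add] at hg
    obtain ⟨h1, h2, h3⟩ := eq_zero_of_rightAct_add_eq_zero hL hq hg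
    refine hg0 (funext fun i => ?_)
    fin_cases i
    exacts [h0, h1, h2, h3]
  let ev : Polynomial F →ₐ[F] MvPolynomial (Fin 3) F := Polynomial.aeval (MvPolynomial.X 0)
  have hev : ∀ (f : Polynomial F) (Y : DiffOp F), Φ (ev f) Y = rightAct L f Y :=
    map_aeval_X_zero hΦ
  let y : MvPolynomial (Fin 3) F := MvPolynomial.X 1 - ev (q.map (constants F).subtype)
  have hy : ∀ Y : DiffOp F, Φ y Y = Y * P := fun Y => by
    rw [map_sub, LinearMap.sub_apply, hΦ, hev, rightAct_map_constants, hP, mul_sub]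
    rfl
  refine ⟨ev (g 0), -(ev (g 1) + ev (g 2) * y + ev (g 3) * y ^ 2), fun h => ?_, ?_⟩
  · rw [mem_extBC_iff hΦ (by omega), hev, rightAct_eq_zero_iff (by omega) one_ne_zero] at h
    exact h0 h
  · rw [map_neg, LinearMap.neg_apply, map_add, map_add, LinearMap.add_apply,
      LinearMap.add_apply, map_mul_apply, map_mul_apply, pow_two, map_mul_apply, hy, hy, one_mul,
      ← pow_two, hev, hev, hev, hev, eq_neg_iff_add_eq_zero, ← hg]
    abel

/-- A monic quadratic polynomial over the polynomials in `λ`, in the form of a characteristic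
polynomial, does not vanish at an operator that commutes with `L` and is no polynomial in `L`. -/
theorem charpoly_notMem_extBC (hΦ : IsPolyAct L A₁ A₂ Φ) (hL : L.order = 3) {A : DiffOp F}
    (hA : Commute L A) (hAL : A ∉ Algebra.adjoin (constants F) {L})
    {x : MvPolynomial (Fin 3) F} (hx : ∀ Y, Φ x Y = Y * A) (a b c d : Polynomial F) :
    (Polynomial.aeval (MvPolynomial.X 0) a - x) * (Polynomial.aeval (MvPolynomial.X 0) d - x) -
        Polynomial.aeval (MvPolynomial.X 0) b * Polynomial.aeval (MvPolynomial.X 0) c ∉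
      extBC L A₁ A₂ := by
  obtain ⟨q, hq⟩ := exists_reduced hL hA hAL
  set P := A - Polynomial.aeval L q with hP
  let ev : Polynomial F →ₐ[F] MvPolynomial (Fin 3) F := Polynomial.aeval (MvPolynomial.X 0)
  have hev : ∀ (f : Polynomial F) (Y : DiffOp F), Φ (ev f) Y = rightAct L f Y :=
    map_aeval_X_zero hΦ
  set r := q.map (constants F).subtype with hr
  let y : MvPolynomial (Fin 3) F := x - ev r
  have hy : ∀ Y : DiffOp F, Φ y Y = Y * P := fun Y => by
    rw [map_sub, LinearMap.sub_apply, hx, hev, rightAct_map_constants, hP, mul_sub]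
  intro h
  -- In terms of y = x - r(λ), which acts as P, the coefficient of y² is 1. This contradicts the
  -- independence of 1, P, P².
  have heq : (ev a - x) * (ev d - x) - ev b * ev c =
      ev ((a - r) * (d - r) - b * c) + ev (2 * r - a - d) * y + ev 1 * y ^ 2 := by
    simp only [map_sub, map_mul, map_one, y, map_ofNat]
    ring
  change (ev a - x) * (ev d - x) - ev b * ev c ∈ _ at h
  rw [heq, mem_extBC_iff hΦ (by omega), map_add, map_add, LinearMap.add_apply,
    LinearMap.add_apply, map_mul_apply, map_mul_apply, pow_two, map_mul_apply, hy, hy, one_mul,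
    ← pow_two, hev, hev, hev] at h
  exact one_ne_zero (eq_zero_of_rightAct_add_eq_zero hL hq h).2.2

end IsPolyAct

/-! ### The common right divisor of order one -/

namespace IsSpectralHom

variable {K : Type*} [Field K] [Differential K] {ι : MvPolynomial (Fin 3) F →+* K}

/-- The map sending the value at an operator of a polynomial to the class of the polynomial. -/
theorem exists_theta (hι : IsSpectralHom L A₁ A₂ ι) (hΦ : IsPolyAct L A₁ A₂ Φ)
    (hL : L.order = 3) (h₁ : Commute L A₁) (hA₁ : A₁ ∉ Algebra.adjoin (constants F) {L}) :
    ∃ θ : DiffOp F → K, ∀ (Q : DiffOp F) (p c : MvPolynomial (Fin 3) F),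
      Φ p Q = Φ c 1 → ι p * θ Q = ι c := by
  have h : ∀ Q : DiffOp F, ∃ t : K, ∀ p c : MvPolynomial (Fin 3) F,
      Φ p Q = Φ c 1 → ι p * t = ι c := by
    intro Q
    obtain ⟨q, d, hq, hd⟩ := hΦ.exists_map_eq_map_one hL h₁ hA₁ Q
    have hq0 : ι q ≠ 0 := mt (hι.eq_zero_iff q).mp hq
    refine ⟨ι d / ι q, fun p c hpc => ?_⟩
    -- The fraction does not depend on the choice: p d and q c both send 1 to the image of Q under p
    -- q.
    have h1 : p * d - q * c ∈ extBC L A₁ A₂ := by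
      rw [hΦ.mem_extBC_iff (by omega), map_sub, LinearMap.sub_apply, IsPolyAct.map_mul_apply,
        IsPolyAct.map_mul_apply, ← hd, ← hpc, IsPolyAct.map_comm_apply, sub_self]
    rw [← hι.eq_zero_iff, map_sub, map_mul, map_mul, sub_eq_zero] at h1
    rw [← mul_div_assoc, h1, mul_div_cancel_left₀ _ hq0]
  choose θ hθ using h
  exact ⟨θ, hθ⟩

/-- An operator of order one dividing `L - λ`, `A₁ - μ₁` and `A₂ - μ₂` on the right. -/
theorem exists_rightDvd (hι : IsSpectralHom L A₁ A₂ ι) (hΦ : IsPolyAct L A₁ A₂ Φ)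
    (hL : L.order = 3) (h₁ : Commute L A₁) (hA₁ : A₁ ∉ Algebra.adjoin (constants F) {L}) :
    ∃ φ : K, ∀ i : Fin 3, DiffOp.RightDvd (del + mulOp φ)
      ((shifted ((![L, A₁, A₂] : Fin 3 → DiffOp F) i) i).map ι) := by
  obtain ⟨θ, hθ⟩ := hι.exists_theta hΦ hL h₁ hA₁
  have htor : ∀ Q : DiffOp F, ∃ p c : MvPolynomial (Fin 3) F, ι p ≠ 0 ∧ Φ p Q = Φ c 1 := by
    intro Q
    obtain ⟨p, c, hp, h⟩ := hΦ.exists_map_eq_map_one hL h₁ hA₁ Q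
    exact ⟨p, c, mt (hι.eq_zero_iff p).mp hp, h⟩
  have hval : ∀ c, θ (Φ c 1) = ι c := fun c => by
    have := hθ (Φ c 1) 1 c (by rw [map_one Φ]; rfl)
    rwa [map_one, one_mul] at this
  have hadd : ∀ P Q, θ (P + Q) = θ P + θ Q := by
    intro P Q
    obtain ⟨p, c, hp, hc⟩ := htor P
    obtain ⟨q, d, hq, hd⟩ := htor Q
    have h := hθ (P + Q) (p * q) (q * c + p * d) (by
      rw [map_add, map_add, LinearMap.add_apply, IsPolyAct.map_mul_apply q c,
        IsPolyAct.map_mul_apply p d, ← hc, ← hd, IsPolyAct.map_mul_apply,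
        IsPolyAct.map_mul_apply, IsPolyAct.map_comm_apply q p])
    rw [map_add, map_mul, map_mul, map_mul, ← hθ P p c hc, ← hθ Q q d hd] at h
    apply mul_left_cancel₀ (mul_ne_zero hp hq)
    linear_combination h
  have hsmul : ∀ (a : F) Q, θ (a • Q) = ι (MvPolynomial.C a) * θ Q := by
    intro a Q
    obtain ⟨q, d, hq, hd⟩ := htor Q
    have h := hθ (a • Q) q (MvPolynomial.C a * d) (by
      rw [IsPolyAct.map_mul_apply, IsPolyAct.map_C, map_smul, hd])
    rw [map_mul, ← hθ Q q d hd] at h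
    apply mul_left_cancel₀ hq
    linear_combination h
  -- Apply ∂ to p·Q = c·1 with the Leibniz rule: p·(∂Q) = c'·1 + c·∂ - p'·Q. Multiplying by p q
  -- turns the terms in ∂ and Q into values at 1, whence the denominator p q p.
  have hdel : ∀ Q, θ (del * Q) = Differential.deriv (θ Q) + θ del * θ Q := by
    intro Q
    obtain ⟨p, c, hp, hc⟩ := htor Q
    obtain ⟨q, d, hq, hd⟩ := htor del
    have hleft := hΦ.del_mul_map p Q
    rw [hc, hΦ.del_mul_map c 1, mul_one] at hleft
    have h := hθ (del * Q) (p * q * p)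
      (p * q * Differential.deriv c + p * c * d - q * Differential.deriv p * c) (by
        rw [IsPolyAct.map_mul_apply, ← add_sub_cancel_left (Φ (Differential.deriv p) Q)
          (Φ p (del * Q)), ← hleft, map_sub, map_add, map_sub, map_add, LinearMap.sub_apply,
          LinearMap.add_apply, IsPolyAct.map_mul_apply (p * c) d, ← hd,
          IsPolyAct.map_mul_apply (q * _) c, ← hc, ← IsPolyAct.map_mul_apply,
          ← IsPolyAct.map_mul_apply, ← IsPolyAct.map_mul_apply, ← IsPolyAct.map_mul_apply,
          ← IsPolyAct.map_mul_apply]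
        congr 3 <;> ring_nf)
    have hc' : ι (Differential.deriv c) =
        ι (Differential.deriv p) * θ Q + ι p * Differential.deriv (θ Q) := by
      rw [hι.map_deriv, ← hθ Q p c hc, Derivation.leibniz, smul_eq_mul, smul_eq_mul,
        ← hι.map_deriv]
      ring
    simp only [map_add, map_sub, map_mul, hc', ← hθ Q p c hc, ← hθ del q d hd] at h
    apply mul_left_cancel₀ (mul_ne_zero (mul_ne_zero hp hq) hp)
    linear_combination h
  set G : DiffOp K := del + mulOp (-θ del) with hG
  have key : ∀ Q : DiffOp F, DiffOp.RightDvd G (Q.map (ι.comp MvPolynomial.C) - mulOp (θ Q)) := by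
    have hd : ∀ a, (ι.comp MvPolynomial.C) (Differential.deriv a) =
        Differential.deriv ((ι.comp MvPolynomial.C) a) := hι.map_C_deriv
    intro Q
    induction Q using induction_on_del with
    | one =>
      have h1 := hval 1
      rw [map_one Φ, Module.End.one_apply, map_one] at h1
      rw [h1, DiffOp.map_one, ← one_eq_mulOp, sub_self]
      exact DiffOp.RightDvd.zero
    | add P Q hP hQ =>
      have h1 : (P + Q).map (ι.comp MvPolynomial.C) - mulOp (θ (P + Q)) =
          P.map (ι.comp MvPolynomial.C) - mulOp (θ P) +
            (Q.map (ι.comp MvPolynomial.C) - mulOp (θ Q)) := by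
        rw [DiffOp.map_add, hadd, mulOp_eq_smul_one, mulOp_eq_smul_one, mulOp_eq_smul_one,
          add_smul]
        abel
      rw [h1]
      exact hP.add hQ
    | smul a Q hQ =>
      have h1 : (a • Q).map (ι.comp MvPolynomial.C) - mulOp (θ (a • Q)) =
          ι (MvPolynomial.C a) • (Q.map (ι.comp MvPolynomial.C) - mulOp (θ Q)) := by
        rw [DiffOp.map_smul, hsmul, mulOp_eq_smul_one, mulOp_eq_smul_one, mul_smul, smul_sub]
        rfl
      rw [h1]
      exact hQ.smul _
    | del_mul Q hQ =>
      -- Since ∂ θ(Q) = θ(Q) ∂ + θ(Q)', the rule for θ(∂Q) leaves exactly the multiple θ(Q) G.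
      have h1 : (del * Q).map (ι.comp MvPolynomial.C) - mulOp (θ (del * Q)) =
          del * (Q.map (ι.comp MvPolynomial.C) - mulOp (θ Q)) + θ Q • G := by
        rw [map_del_mul _ hd, hdel, hG, mul_sub, mulOp_eq_smul_one (θ Q), del_mul_smul, mul_one,
          mulOp_eq_smul_one, mulOp_eq_smul_one, smul_add, smul_smul, add_smul, mul_neg, neg_smul,
          mul_comm (θ del)]
        abel
      rw [h1]
      exact (hQ.mul_left del).add (DiffOp.RightDvd.smul ⟨1, (one_mul G).symm⟩ _)
  refine ⟨-θ del, fun i => ?_⟩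
  -- The variables act on 1 by giving L, A₁, A₂, so θ takes the values λ, μ₁, μ₂ there.
  have h1 := hval (MvPolynomial.X i)
  rw [hΦ, one_mul] at h1
  have h2 := key ((![L, A₁, A₂] : Fin 3 → DiffOp F) i)
  rwa [h1, ← DiffOp.map_map, ← DiffOp.map_mulOp, ← DiffOp.map_sub] at h2

end IsSpectralHom

end

/-! ### Subresultants and right divisors of order one -/

namespace DiffOp

section Map

variable {R S : Type*} [CommRing R] [Differential R] [CommRing S] [Differential S]

/-- The determinant defining the coefficients of the subresultants, for prescribed orders `n` and
`m` of the operators. -/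
def subresDet (P Q : DiffOp R) (n m k i : ℕ) : R :=
  (Matrix.of fun r c : Fin ((m - k) + (n - k)) =>
    (if (r : ℕ) < m - k then del ^ (m - k - 1 - r) * P
      else del ^ (n - k - 1 - (r - (m - k))) * Q : DiffOp R).coeff
    (if (c : ℕ) + 1 = (m - k) + (n - k) then i else n + m - k - 1 - c)).det

theorem subresCoeff_eq_subresDet (P Q : DiffOp R) (k i : ℕ) :
    subresCoeff P Q k i = subresDet P Q P.order Q.order k i := rfl

theorem map_subresDet (f : R →+* S)
    (hf : ∀ a, f (Differential.deriv a) = Differential.deriv (f a)) (P Q : DiffOp R)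
    (n m k i : ℕ) : f (subresDet P Q n m k i) = subresDet (P.map f) (Q.map f) n m k i := by
  rw [subresDet, subresDet, RingHom.map_det]
  congr 1
  ext r c
  rw [RingHom.mapMatrix_apply, Matrix.map_apply, Matrix.of_apply, Matrix.of_apply, ← coeff_map,
    apply_ite (DiffOp.map f), map_del_pow_mul f hf, map_del_pow_mul f hf]

/-- The orders fix the size and the columns of the matrix, so they must survive the homomorphism. -/
theorem map_subresCoeff (f : R →+* S)
    (hf : ∀ a, f (Differential.deriv a) = Differential.deriv (f a)) {P Q : DiffOp R}
    (hP : (P.map f).order = P.order) (hQ : (Q.map f).order = Q.order) (k i : ℕ) :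
    f (subresCoeff P Q k i) = subresCoeff (P.map f) (Q.map f) k i := by
  rw [subresCoeff_eq_subresDet, subresCoeff_eq_subresDet, map_subresDet f hf, hP, hQ]

end Map

variable {K : Type*} [Field K] [Differential K]

theorem coeff_del_add_mulOp (φ : K) (k : ℕ) :
    (del + mulOp φ).coeff k = if k = 1 then 1 else if k = 0 then φ else 0 := by
  rw [coeff_add, coeff_del, coeff_mulOp]
  split_ifs <;> simp_all

theorem order_del_add_mulOp (φ : K) : (del + mulOp φ).order = 1 := by
  refine order_eq (fun k hk => ?_) ?_
  · rw [coeff_del_add_mulOp, if_neg (by omega), if_neg (by omega)]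
  · rw [coeff_del_add_mulOp, if_pos rfl]
    exact one_ne_zero

theorem monic_del_add_mulOp (φ : K) : (del + mulOp φ).Monic := by
  have h : (del + mulOp φ).coeff (del + mulOp φ).order = 1 := by
    rw [order_del_add_mulOp, coeff_del_add_mulOp, if_pos rfl]
  exact h

theorem eq_zero_of_sum_smul_del_pow_eq_zero {k : ℕ} {v : Fin k → K}
    (h : ∑ r : Fin k, v r • (del ^ (k - 1 - (r : ℕ)) : DiffOp K) = 0) : v = 0 := by
  have hc : ∀ (s : Finset (Fin k)) (j : ℕ),
      (∑ r ∈ s, v r • (del ^ (k - 1 - (r : ℕ)) : DiffOp K)).coeff j =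
        ∑ r ∈ s, if j = k - 1 - (r : ℕ) then v r else 0 := by
    intro s j
    induction s using Finset.induction_on with
    | empty => simp [coeff_zero]
    | insert a s ha ih =>
      rw [Finset.sum_insert ha, Finset.sum_insert ha, coeff_add, ih, coeff_smul, coeff_del_pow]
      simp
  funext r₀
  have h0 := hc Finset.univ (k - 1 - (r₀ : ℕ))
  rw [h, coeff_zero, Finset.sum_eq_single r₀ (fun r _ hr => if_neg (fun he => hr (Fin.ext
    (by omega)))) (fun hr => absurd (Finset.mem_univ r₀) hr), if_pos rfl] at h0
  exact h0.symm

/-! ### The first subresultant as a Bézout combination. -/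

section Gcrd

variable {P Q : DiffOp K}

theorem subresRow_mem_below (hP : 1 ≤ P.order) (hQ : 1 ≤ Q.order)
    (r : Fin ((Q.order - 1) + (P.order - 1))) :
    subresRow P Q 1 r ∈ below K ((Q.order - 1) + (P.order - 1) + 1) := by
  have hr := r.2
  rw [subresRow]
  split_ifs with h
  · exact below_mono (by omega) (del_pow_mul_mem_below (mem_below_order P) _)
  · exact below_mono (by omega) (del_pow_mul_mem_below (mem_below_order Q) _)

theorem RightDvd.subresRow {G : DiffOp K} (hP : RightDvd G P) (hQ : RightDvd G Q) (k r : ℕ) :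
    RightDvd G (subresRow P Q k r) := by
  rw [DiffOp.subresRow]
  split_ifs
  exacts [hP.mul_left _, hQ.mul_left _]

theorem coeff_sum_smul {ι : Type*} (s : Finset ι) (v : ι → K) (Y : ι → DiffOp K) (j : ℕ) :
    (∑ r ∈ s, v r • Y r).coeff j = ∑ r ∈ s, v r * (Y r).coeff j := by
  classical
  induction s using Finset.induction_on with
  | empty => simp [coeff_zero]
  | insert a s ha ih => rw [Finset.sum_insert ha, Finset.sum_insert ha, coeff_add, ih, coeff_smul]

/-- If a combination of the rows of the subresultant matrix has coefficients
`(0, …, 0, t)`, then it is the multiple by `t` of any common right divisor of order one. -/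
theorem sum_smul_subresRow_eq {φ : K} (hP : 2 ≤ P.order) (hQ : 1 ≤ Q.order)
    (hGP : RightDvd (del + mulOp φ) P) (hGQ : RightDvd (del + mulOp φ) Q)
    (v : Fin ((Q.order - 1) + (P.order - 1)) → K) (t : K)
    (hv : ∀ c : Fin ((Q.order - 1) + (P.order - 1)),
      Matrix.vecMul v (subresMatrix P Q 1 1) c =
        if (c : ℕ) + 1 = (Q.order - 1) + (P.order - 1) then t else 0) :
    ∑ r, v r • subresRow P Q 1 r = t • (del + mulOp φ) := by
  have hcoeff : ∀ j, 1 ≤ j → (∑ r, v r • subresRow P Q 1 r).coeff j = if j = 1 then t else 0 := by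
    intro j hj
    by_cases hjN : j ≤ (Q.order - 1) + (P.order - 1)
    -- With N = n + m - 2 columns, column c holds the coefficient of ∂^(N-c); for i = 1 the last
    -- column follows the same rule.
    · have h := hv ⟨(Q.order - 1) + (P.order - 1) - j, by omega⟩
      rw [coeff_sum_smul]
      rw [Matrix.vecMul, dotProduct] at h
      simp only [subresMatrix] at h
      by_cases hj1 : j = 1
      · have hc : (Q.order - 1) + (P.order - 1) - j + 1 = (Q.order - 1) + (P.order - 1) := by omega
        simp only [if_pos hc] at h
        rw [if_pos hj1, hj1]
        exact h
      · have hc : ¬ (Q.order - 1) + (P.order - 1) - j + 1 = (Q.order - 1) + (P.order - 1) := by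
          omega
        have hidx : P.order + Q.order - 1 - 1 - ((Q.order - 1) + (P.order - 1) - j) = j := by omega
        simp only [if_neg hc, hidx] at h
        rw [if_neg hj1]
        exact h
    · rw [if_neg (by omega)]
      have hmem : ∑ r : Fin ((Q.order - 1) + (P.order - 1)), v r • subresRow P Q 1 r ∈
          below K ((Q.order - 1) + (P.order - 1) + 1) :=
        Submodule.sum_mem _ fun r _ =>
          Submodule.smul_mem _ (v r) (subresRow_mem_below (by omega) hQ r)
      exact hmem j (by omega)
  -- The difference has only a term of order zero and is divisible by an operator of order one.
  refine sub_eq_zero.mp (RightDvd.eq_zero (G := del + mulOp φ) ?_ ?_)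
  · have hdvd : RightDvd (del + mulOp φ) (∑ r, v r • subresRow P Q 1 r) :=
      RightDvd.sum fun r _ => (hGP.subresRow hGQ 1 (r : ℕ)).smul (v r)
    exact hdvd.sub (RightDvd.smul ⟨1, (one_mul _).symm⟩ t)
  · rw [order_del_add_mulOp]
    intro j hj
    rw [coeff_sub, hcoeff j hj, coeff_smul, coeff_del_add_mulOp]
    split_ifs
    · simp
    · omega
    · simp

/-- The two blocks of rows give a combination U P + V Q; a block without rows gives a zero cofactor.
-/
theorem sum_smul_subresRow_eq_mul_add_mul
    (v : Fin ((Q.order - 1) + (P.order - 1)) → K) :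
    ∑ r, v r • subresRow P Q 1 r =
      (∑ r, v (Fin.castAdd _ r) • (del ^ (Q.order - 1 - 1 - (r : ℕ)) : DiffOp K)) * P +
        (∑ r, v (Fin.natAdd _ r) • (del ^ (P.order - 1 - 1 - (r : ℕ)) : DiffOp K)) * Q := by
  rw [Fin.sum_univ_add, Finset.sum_mul, Finset.sum_mul]
  congr 1
  · refine Finset.sum_congr rfl fun r _ => ?_
    rw [smul_mul, subresRow, Fin.val_castAdd, if_pos r.2]
  · refine Finset.sum_congr rfl fun r _ => ?_
    rw [smul_mul, subresRow, Fin.val_natAdd, if_neg (by omega), Nat.add_sub_cancel_left]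

/-- Let `∂ + φ` be a common right divisor of `P` and `Q`. If `P` does not divide `V Q` on the
right for nonzero `V` of order less than the order of `P` minus one, then `∂ + φ` is the greatest
common right divisor and is proportional to the first subresultant. -/
theorem isMonicGcrd_of_subres {φ : K} (hP : 2 ≤ P.order) (hQ : 1 ≤ Q.order)
    (hGP : RightDvd (del + mulOp φ) P) (hGQ : RightDvd (del + mulOp φ) Q)
    (hV : ∀ V ∈ below K (P.order - 1), RightDvd P (V * Q) → V = 0) :
    IsMonicGcrd {P, Q} (del + mulOp φ) ∧ subresCoeff P Q 1 1 ≠ 0 ∧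
      subresCoeff P Q 1 0 = φ * subresCoeff P Q 1 1 := by
  set M₁ := subresMatrix P Q 1 1 with hM₁
  set M₀ := subresMatrix P Q 1 0 with hM₀
  have hdet : M₁.det ≠ 0 := by
    -- A kernel vector yields U P + V Q = 0 with V of order less than ord P - 1. Then V = 0 by
    -- hypothesis, hence U = 0, and the vector vanishes.
    intro h0
    obtain ⟨v, hv0, hv⟩ := Matrix.exists_vecMul_eq_zero_iff.mpr h0
    have h1 := sum_smul_subresRow_eq hP hQ hGP hGQ v 0 (fun c => by
      rw [← hM₁, hv, ite_self]
      rfl)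
    rw [zero_smul, sum_smul_subresRow_eq_mul_add_mul] at h1
    set U := ∑ r, v (Fin.castAdd _ r) • (del ^ (Q.order - 1 - 1 - (r : ℕ)) : DiffOp K) with hU
    set V := ∑ r, v (Fin.natAdd _ r) • (del ^ (P.order - 1 - 1 - (r : ℕ)) : DiffOp K) with hVdef
    have hV0 : V = 0 := by
      refine hV V ?_ ⟨-U, ?_⟩
      · refine Submodule.sum_mem _ fun r _ => Submodule.smul_mem _ _ fun j hj => ?_
        have hr := r.2
        rw [coeff_del_pow, if_neg (by omega)]
      · rw [neg_mul, eq_neg_iff_add_eq_zero, add_comm, h1]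
    have hU0 : U = 0 := by
      rw [hV0, zero_mul, add_zero] at h1
      refine (mul_eq_zero.mp h1).resolve_right ?_
      rintro rfl
      simp [order_zero] at hP
    have h2 := eq_zero_of_sum_smul_del_pow_eq_zero hU0
    have h3 := eq_zero_of_sum_smul_del_pow_eq_zero hV0
    refine hv0 (funext fun r => ?_)
    induction r using Fin.addCases with
    | left r => exact congrFun h2 r
    | right r => exact congrFun h3 r
  let last : Fin ((Q.order - 1) + (P.order - 1)) :=
    ⟨(Q.order - 1) + (P.order - 1) - 1, by omega⟩
  have hlast : ∀ c : Fin ((Q.order - 1) + (P.order - 1)),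
      (c : ℕ) + 1 = (Q.order - 1) + (P.order - 1) ↔ c = last := by
    intro c
    rw [Fin.ext_iff]
    simp only [last]
    omega
  -- The last row of the inverse: the combination with these coefficients is ∂ + φ itself, a Bézout
  -- identity.
  set v := Matrix.vecMul (Pi.single last (1 : K)) M₁⁻¹ with hvdef
  have hvM : Matrix.vecMul v M₁ = Pi.single last 1 := by
    rw [hvdef, Matrix.vecMul_vecMul, Matrix.nonsing_inv_mul _ (isUnit_iff_ne_zero.mpr hdet),
      Matrix.vecMul_one]
  have hv0 : v ≠ 0 := by
    intro h
    rw [h, Matrix.zero_vecMul] at hvM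
    have := congrFun hvM last
    rw [Pi.single_eq_same, Pi.zero_apply] at this
    exact zero_ne_one this
  have hsum := sum_smul_subresRow_eq hP hQ hGP hGQ v 1 (fun c => by
    rw [← hM₁, hvM, Pi.single_apply]
    simp only [hlast])
  rw [one_smul] at hsum
  have hcol : ∀ r c, c ≠ last → M₀ r c = M₁ r c := by
    intro r c hc
    rw [hM₀, hM₁, subresMatrix, subresMatrix, if_neg (mt (hlast c).mp hc),
      if_neg (mt (hlast c).mp hc)]
  have hvM₀ : Matrix.vecMul v M₀ last = φ := by
    have h1 := congrArg (fun Y => coeff Y 0) hsum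
    simp only [coeff_sum_smul, coeff_del_add_mulOp] at h1
    rw [if_neg zero_ne_one, if_pos trivial] at h1
    rw [← h1, Matrix.vecMul, dotProduct]
    refine Finset.sum_congr rfl fun r _ => ?_
    rw [hM₀, subresMatrix, if_pos ((hlast last).mpr rfl)]
  refine ⟨⟨monic_del_add_mulOp φ, ?_, ?_⟩, hdet, ?_⟩
  · rintro Y (rfl | rfl)
    exacts [hGP, hGQ]
  · intro H hH
    rw [← hsum]
    exact RightDvd.sum fun r _ => ((hH P (by simp)).subresRow (hH Q (by simp)) 1 r).smul (v r)
  -- M₀ and M₁ differ only in the last column, and v maps these last columns to φ and 1. Hence v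
  -- annihilates the modified matrix, and linearity in that column gives det M₀ = φ det M₁.
  · have hM' : (M₁.updateCol last ((fun r => M₀ r last) + (-φ) • fun r => M₁ r last)).det = 0 := by
      refine Matrix.exists_vecMul_eq_zero_iff.mp ⟨v, hv0, funext fun c => ?_⟩
      by_cases hc : c = last
      · subst hc
        have h1 := congrFun hvM last
        rw [Pi.single_eq_same] at h1
        simp only [Matrix.vecMul, dotProduct, Matrix.updateCol_self, Pi.add_apply, Pi.smul_apply,
          smul_eq_mul, mul_add, Finset.sum_add_distrib, Pi.zero_apply] at h1 hvM₀ ⊢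
        rw [hvM₀]
        simp only [mul_left_comm _ (-φ), ← Finset.mul_sum]
        rw [h1]
        ring
      · have h1 := congrFun hvM c
        rw [Pi.single_eq_of_ne hc] at h1
        rw [Pi.zero_apply, ← h1]
        simp only [Matrix.vecMul, dotProduct, Matrix.updateCol_ne hc]
    rw [Matrix.det_updateCol_add, Matrix.det_updateCol_smul, Matrix.updateCol_eq_self] at hM'
    have h0 : M₁.updateCol last (fun r => M₀ r last) = M₀ := by
      ext r c
      by_cases hc : c = last
      · rw [hc, Matrix.updateCol_self]
      · rw [Matrix.updateCol_ne hc, hcol r c hc]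
    rw [h0] at hM'
    change M₀.det = φ * M₁.det
    linear_combination hM'

end Gcrd

end DiffOp

/-! ### Greatest common right divisors on the spectral curve -/

section Spectral

variable {F : Type*} [Field F] [Differential F] {L A₁ A₂ : DiffOp F}

theorem order_map_sub_mulOp {S : Type*} [CommRing S] [Nontrivial S] (f : F →+* S) {A : DiffOp F}
    (hA : 1 ≤ A.order) (x : S) : (A.map f - mulOp x).order = A.order := by
  have hA0 : A ≠ 0 := by
    rintro rfl
    simp [order_zero] at hA
  refine order_eq (fun k hk => ?_) ?_
  · rw [coeff_sub, coeff_map, coeff_mulOp, if_neg (by omega), mem_below_order A k hk, map_zero,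
      sub_zero]
  · rw [coeff_sub, coeff_map, coeff_mulOp, if_neg (by omega), sub_zero]
    exact (map_ne_zero f).mpr (coeff_order_ne_zero hA0)

variable {K : Type*} [Field K] [Differential K] {ι : MvPolynomial (Fin 3) F →+* K}

theorem map_shifted (A : DiffOp F) (i : Fin 3) :
    (shifted A i).map ι = A.map (ι.comp MvPolynomial.C) - mulOp (ι (MvPolynomial.X i)) := by
  rw [shifted, DiffOp.map_sub, DiffOp.map_map, map_mulOp]

theorem order_map_shifted {A : DiffOp F} (hA : 1 ≤ A.order) (i : Fin 3) :
    ((shifted A i).map ι).order = A.order := by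
  rw [map_shifted, order_map_sub_mulOp _ hA]

theorem mul_mulOp_of_deriv_eq_zero {c : K} (hc : Differential.deriv c = 0) (P : DiffOp K) :
    P * mulOp c = c • P := by
  rw [mulOp_eq_smul_one, mul_smul_of_deriv_eq_zero c hc, mul_one]

namespace IsSpectralHom

/-- Modulo `L - λ`, right multiplication by `L` is multiplication by `λ`. -/
theorem rightDvd_map_rightAct (hι : IsSpectralHom L A₁ A₂ ι) (g : Polynomial F) (P : DiffOp F) :
    DiffOp.RightDvd ((shifted L 0).map ι) ((rightAct L g P).map (ι.comp MvPolynomial.C) -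
      ι (Polynomial.aeval (MvPolynomial.X 0) g) • P.map (ι.comp MvPolynomial.C)) := by
  induction g using Polynomial.induction_on' with
  | add p q hp hq =>
    have h := hp.add hq
    rwa [sub_add_sub_comm, ← DiffOp.map_add, ← add_smul, ← LinearMap.add_apply, ← map_add,
      ← map_add, ← map_add] at h
  | monomial k a =>
    have hpow : DiffOp.RightDvd ((shifted L 0).map ι) ((P * L ^ k).map (ι.comp MvPolynomial.C) -
        ι (MvPolynomial.X 0) ^ k • P.map (ι.comp MvPolynomial.C)) := by
      induction k with
      | zero =>
        rw [pow_zero, mul_one, pow_zero, one_smul, sub_self]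
        exact RightDvd.zero
      | succ k ih =>
        have h : (P * L ^ (k + 1)).map (ι.comp MvPolynomial.C) -
            ι (MvPolynomial.X 0) ^ (k + 1) • P.map (ι.comp MvPolynomial.C) =
            (P * L ^ k).map (ι.comp MvPolynomial.C) * (shifted L 0).map ι +
              ι (MvPolynomial.X 0) • ((P * L ^ k).map (ι.comp MvPolynomial.C) -
                ι (MvPolynomial.X 0) ^ k • P.map (ι.comp MvPolynomial.C)) := by
          rw [pow_succ, ← mul_assoc, DiffOp.map_mul _ hι.map_C_deriv (P * L ^ k), map_shifted,
            mul_sub, mul_mulOp_of_deriv_eq_zero (hι.deriv_map_X 0), smul_sub, smul_smul, pow_succ']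
          abel
        rw [h]
        exact DiffOp.RightDvd.add ⟨_, rfl⟩ (ih.smul _)
    have h := hpow.smul (ι (MvPolynomial.C a))
    rw [← Polynomial.C_mul_X_pow_eq_monomial, map_mul, Module.End.mul_apply, rightAct_C,
      rightAct_X_pow, map_mul, map_pow, Polynomial.aeval_C, Polynomial.aeval_X, map_mul, map_pow,
      mul_smul, DiffOp.map_smul, MvPolynomial.algebraMap_eq]
    rwa [smul_sub] at h

variable [CharZero F] {Φ : MvPolynomial (Fin 3) F →ₐ[F] Module.End F (DiffOp F)}

/-- `L - λ` and `A - x` have no common left multiple of the form `V (A - x)` with `V ≠ 0` of order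
at most one, if `A` commutes with `L` and is no polynomial in `L`. -/
theorem eq_zero_of_rightDvd_mul (hι : IsSpectralHom L A₁ A₂ ι) (hΦ : IsPolyAct L A₁ A₂ Φ)
    (hL : L.order = 3) {A : DiffOp F} (hA : Commute L A)
    (hAL : A ∉ Algebra.adjoin (constants F) {L}) {i : Fin 3}
    (hi : A = (![L, A₁, A₂] : Fin 3 → DiffOp F) i) {V : DiffOp K} (hV : V ∈ below K 2)
    (h : DiffOp.RightDvd ((shifted L 0).map ι) (V * (shifted A i).map ι)) : V = 0 := by
  -- With L replaced by λ, a and b become the first two rows of the matrix of right multiplication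
  -- by A on remainders modulo L - λ, in the basis 1, ∂, ∂².
  obtain ⟨a, ha⟩ := exists_eq_sum_rightAct hL A
  obtain ⟨b, hb⟩ := exists_eq_sum_rightAct hL (del * A)
  set e : Polynomial F → K := fun g => ι (Polynomial.aeval (MvPolynomial.X 0) g) with he
  set x := ι (MvPolynomial.X i)
  have hVeq : V = V.coeff 0 • 1 + V.coeff 1 • del := by
    have := eq_sum_of_mem_below hV
    simpa [Finset.sum_range_succ] using this
  have hred : ∀ (Q : DiffOp F) (c : Fin 3 → Polynomial F),
      Q = ∑ j, rightAct L (c j) (del ^ (j : ℕ)) →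
        DiffOp.RightDvd ((shifted L 0).map ι) (Q.map (ι.comp MvPolynomial.C) -
          (e (c 0) • 1 + e (c 1) • del + e (c 2) • del ^ 2)) := by
    intro Q c hQ
    have hdel : ∀ j : ℕ, (del ^ j : DiffOp F).map (ι.comp MvPolynomial.C) = del ^ j := by
      intro j
      have := map_del_pow_mul (ι.comp MvPolynomial.C) hι.map_C_deriv j 1
      rwa [mul_one, DiffOp.map_one, mul_one] at this
    have h0 := hι.rightDvd_map_rightAct (c 0) 1
    have h1 := hι.rightDvd_map_rightAct (c 1) (del ^ 1)
    have h2 := hι.rightDvd_map_rightAct (c 2) (del ^ 2)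
    rw [DiffOp.map_one] at h0
    rw [hdel] at h1 h2
    have h3 := (h0.add h1).add h2
    rw [sub_add_sub_comm, sub_add_sub_comm, ← DiffOp.map_add, ← DiffOp.map_add] at h3
    rw [hQ, Fin.sum_univ_three]
    simpa using h3
  have hrem := (((hred A a ha).smul (V.coeff 0)).add ((hred _ b hb).smul (V.coeff 1)))
  have hrem' := h.sub hrem
  have hxx : Differential.deriv x = 0 := hι.deriv_map_X i
  have heq : V * (shifted A i).map ι - (V.coeff 0 • (A.map (ι.comp MvPolynomial.C) -
        (e (a 0) • 1 + e (a 1) • del + e (a 2) • del ^ 2)) +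
      V.coeff 1 • ((del * A).map (ι.comp MvPolynomial.C) -
        (e (b 0) • 1 + e (b 1) • del + e (b 2) • del ^ 2))) =
      (V.coeff 0 * e (a 0) + V.coeff 1 * e (b 0) - x * V.coeff 0) • 1 +
        (V.coeff 0 * e (a 1) + V.coeff 1 * e (b 1) - x * V.coeff 1) • del +
          (V.coeff 0 * e (a 2) + V.coeff 1 * e (b 2)) • (del ^ 2 : DiffOp K) := by
    conv_lhs => rw [hVeq]
    rw [map_shifted, mul_sub, mul_mulOp_of_deriv_eq_zero hxx, add_mul, smul_mul, smul_mul, one_mul,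
      map_del_mul _ hι.map_C_deriv]
    simp only [coeff_add, coeff_smul, coeff_one, coeff_del]
    simp only [zero_ne_one, one_ne_zero, if_true, if_false, mul_zero, mul_one, add_zero, zero_add]
    module
  rw [heq] at hrem'
  set s₀ := V.coeff 0 * e (a 0) + V.coeff 1 * e (b 0) - x * V.coeff 0 with hs₀
  set s₁ := V.coeff 0 * e (a 1) + V.coeff 1 * e (b 1) - x * V.coeff 1 with hs₁
  have hcoeff : ∀ k, (s₀ • 1 + s₁ • del +
      (V.coeff 0 * e (a 2) + V.coeff 1 * e (b 2)) • (del ^ 2 : DiffOp K)).coeff k =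
      s₀ * (if k = 0 then 1 else 0) + s₁ * (if k = 1 then 1 else 0) +
        (V.coeff 0 * e (a 2) + V.coeff 1 * e (b 2)) * (if k = 2 then 1 else 0) := fun k => by
    rw [coeff_add, coeff_add, coeff_smul, coeff_smul, coeff_smul, coeff_one, coeff_del,
      coeff_del_pow]
  -- The remainder has order less than 3 and is divisible by L - λ, of order 3.
  have hzero := hrem'.eq_zero (by
    rw [order_map_shifted (by omega), hL]
    intro k hk
    rw [hcoeff, if_neg (by omega), if_neg (by omega), if_neg (by omega)]
    ring)
  have h0 : s₀ = 0 := by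
    have := hcoeff 0
    rw [hzero, coeff_zero] at this
    simpa using this.symm
  have h1 : s₁ = 0 := by
    have := hcoeff 1
    rw [hzero, coeff_zero] at this
    simpa using this.symm
  -- The coefficients of 1 and ∂ form a homogeneous system in the two coefficients of V. Its
  -- determinant is the characteristic polynomial, at x, of a 2×2 block; Cramer's rule follows.
  have hchar := hΦ.charpoly_notMem_extBC hL hA hAL (x := MvPolynomial.X i)
    (fun Y => by rw [hΦ, hi]) (a 0) (b 0) (a 1) (b 1)
  rw [← hι.eq_zero_iff, map_sub, map_mul, map_sub, map_sub, map_mul] at hchar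
  change (e (a 0) - x) * (e (b 1) - x) - e (b 0) * e (a 1) ≠ 0 at hchar
  have hv0 : V.coeff 0 = 0 := by
    refine (mul_eq_zero.mp ?_).resolve_right hchar
    linear_combination (e (b 1) - x) * (hs₀.symm.trans h0) - e (b 0) * (hs₁.symm.trans h1)
  have hv1 : V.coeff 1 = 0 := by
    refine (mul_eq_zero.mp ?_).resolve_right hchar
    linear_combination (e (a 0) - x) * (hs₁.symm.trans h1) - e (a 1) * (hs₀.symm.trans h0)
  rw [hVeq, hv0, hv1, zero_smul, zero_smul, add_zero]

end IsSpectralHom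

end Spectral

/-! ### The main theorem -/

section Main

variable {F : Type*} [Field F] [Differential F] {L A₁ A₂ : DiffOp F}

/-- An operator of order zero commuting with L is a constant, by comparison of its leading
coefficient with that of 1. -/
theorem one_le_order_of_notMem_adjoin [CharZero F] (hL : 0 < L.order) {A : DiffOp F}
    (hA : Commute L A) (hAL : A ∉ Algebra.adjoin (constants F) {L}) : 1 ≤ A.order := by
  by_contra h
  have h0 : A ∈ below F (0 + 1) := by
    have := mem_below_order A
    rwa [show A.order = 0 by omega] at this
  have hone : (1 : DiffOp F) ∈ below F (0 + 1) := mulOp_mem_below 1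
  obtain ⟨c, hc⟩ := exists_constant_coeff_eq hL hA (Commute.one_right L) h0 hone
    (by rw [coeff_one, if_pos rfl]; exact one_ne_zero)
  refine hAL ?_
  have hAc : A = c • (1 : DiffOp F) := by
    rw [constants_smul_def]
    refine sub_eq_zero.mp (eq_zero_of_mem_below_zero (mem_below_of_succ
      (Submodule.sub_mem _ h0 (Submodule.smul_mem _ _ hone)) ?_))
    rw [coeff_sub, coeff_smul, hc, sub_self]
  rw [hAc]
  exact Subalgebra.smul_mem _ (Subalgebra.one_mem _) c

theorem notMem_adjoin_of_linearIndependent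
    (hindep : LinearIndependent (Algebra.adjoin (constants F) {L}) ![1, A₁, A₂]) :
    A₁ ∉ Algebra.adjoin (constants F) {L} ∧ A₂ ∉ Algebra.adjoin (constants F) {L} := by
  rw [Fintype.linearIndependent_iff] at hindep
  constructor
  · intro h
    have h1 := hindep ![⟨A₁, h⟩, -1, 0] (by
      simp [Fin.sum_univ_three, Subalgebra.smul_def]) 1
    exact one_ne_zero (neg_eq_zero.mp h1)
  · intro h
    have h1 := hindep ![⟨A₂, h⟩, 0, -1] (by
      simp [Fin.sum_univ_three, Subalgebra.smul_def]) 2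
    exact one_ne_zero (neg_eq_zero.mp h1)

theorem commute_of_mem_span_eq_centralizer
    (hspan : (Submodule.span (Algebra.adjoin (constants F) {L}) {1, A₁, A₂} : Set (DiffOp F)) =
      Set.centralizer {L}) {A : DiffOp F} (hA : A ∈ ({1, A₁, A₂} : Set (DiffOp F))) :
    Commute L A := by
  have h : A ∈ (Submodule.span (Algebra.adjoin (constants F) {L}) {1, A₁, A₂} :
      Set (DiffOp F)) := Submodule.subset_span hA
  rw [hspan, Set.mem_centralizer_iff] at h
  exact h L rfl

theorem isSpectralHom_toSpectralField [IsDomain (SpectralRing L A₁ A₂)] :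
    IsSpectralHom L A₁ A₂ (toSpectralField L A₁ A₂) where
  eq_zero_iff p := by
    rw [toSpectralField, RingHom.comp_apply, ← Ideal.Quotient.eq_zero_iff_mem]
    exact map_eq_zero_iff _ (IsFractionRing.injective (SpectralRing L A₁ A₂)
      (SpectralField L A₁ A₂))
  map_deriv p := by
    rw [toSpectralField, RingHom.comp_apply, ← spectralDeriv_mk]
    exact (fracDeriv_algebraMap _ _ _).symm

end Main

theorem theorem7 {F : Type*} [Field F] [CharZero F] [Differential F] [IsAlgClosed (constants F)]
    (L A₁ A₂ : DiffOp F) (hL : L.order = 3)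
    (hindep : LinearIndependent (Algebra.adjoin (constants F) {L}) ![1, A₁, A₂])
    (hspan : (Submodule.span (Algebra.adjoin (constants F) {L}) {1, A₁, A₂} : Set (DiffOp F)) =
      Set.centralizer {L}) :
    ∃ _ : IsDomain (SpectralRing L A₁ A₂), ∃ φ : SpectralField L A₁ A₂,
      DiffOp.IsMonicGcrd
          {(shifted L 0).map (toSpectralField L A₁ A₂),
            (shifted A₁ 1).map (toSpectralField L A₁ A₂),
            (shifted A₂ 2).map (toSpectralField L A₁ A₂)}
          (DiffOp.del + DiffOp.mulOp φ) ∧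
        ∀ P ∈ ({shifted A₁ 1, shifted A₂ 2} : Set (DiffOp (MvPolynomial (Fin 3) F))),
          DiffOp.IsMonicGcrd
              {(shifted L 0).map (toSpectralField L A₁ A₂), P.map (toSpectralField L A₁ A₂)}
              (DiffOp.del + DiffOp.mulOp φ) ∧
            toSpectralField L A₁ A₂ (DiffOp.subresCoeff (shifted L 0) P 1 1) ≠ 0 ∧
            φ = toSpectralField L A₁ A₂ (DiffOp.subresCoeff (shifted L 0) P 1 0) /
              toSpectralField L A₁ A₂ (DiffOp.subresCoeff (shifted L 0) P 1 1) := by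
  have h₁ : Commute L A₁ := commute_of_mem_span_eq_centralizer hspan (by simp)
  have h₂ : Commute L A₂ := commute_of_mem_span_eq_centralizer hspan (by simp)
  obtain ⟨hA₁, hA₂⟩ := notMem_adjoin_of_linearIndependent hindep
  obtain ⟨Φ, hΦ⟩ := exists_polyAct h₁ h₂ (commute_of_span_eq_centralizer hL hspan h₁ h₂ hA₁)
  have hprime : (extBC L A₁ A₂).IsPrime := hΦ.isPrime_extBC (by omega)
  have hdom : IsDomain (SpectralRing L A₁ A₂) := Ideal.Quotient.isDomain _
  refine ⟨hdom, ?_⟩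
  have hι := isSpectralHom_toSpectralField (L := L) (A₁ := A₁) (A₂ := A₂)
  obtain ⟨φ, hφ⟩ := hι.exists_rightDvd hΦ hL h₁ hA₁
  have hpair : ∀ (i : Fin 3) (A : DiffOp F), A = (![L, A₁, A₂] : Fin 3 → DiffOp F) i →
      Commute L A → A ∉ Algebra.adjoin (constants F) {L} →
      DiffOp.IsMonicGcrd {(shifted L 0).map (toSpectralField L A₁ A₂),
          (shifted A i).map (toSpectralField L A₁ A₂)} (DiffOp.del + DiffOp.mulOp φ) ∧
        toSpectralField L A₁ A₂ (DiffOp.subresCoeff (shifted L 0) (shifted A i) 1 1) ≠ 0 ∧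
        φ = toSpectralField L A₁ A₂ (DiffOp.subresCoeff (shifted L 0) (shifted A i) 1 0) /
          toSpectralField L A₁ A₂ (DiffOp.subresCoeff (shifted L 0) (shifted A i) 1 1) := by
    intro i A hi hA hAL
    have hA1 := one_le_order_of_notMem_adjoin (by omega) hA hAL
    have hL1 : 1 ≤ L.order := by omega
    have hLord := order_map_shifted (ι := toSpectralField L A₁ A₂) hL1 0
    have hAord := order_map_shifted (ι := toSpectralField L A₁ A₂) hA1 i
    -- Subtracting a variable does not change a positive order, so the subresultants may be computed
    -- after passing to F(Γ).
    have hmap := map_subresCoeff (toSpectralField L A₁ A₂) hι.map_deriv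
      (hLord.trans (order_map_sub_mulOp _ hL1 _).symm)
      (hAord.trans (order_map_sub_mulOp _ hA1 _).symm) 1
    have hGL : DiffOp.RightDvd (DiffOp.del + DiffOp.mulOp φ)
        ((shifted L 0).map (toSpectralField L A₁ A₂)) := hφ 0
    obtain ⟨hg, hne, heq⟩ := isMonicGcrd_of_subres (φ := φ) (by omega) (by omega) hGL
      (hi ▸ hφ i) (fun V hV h => by
        refine hι.eq_zero_of_rightDvd_mul hΦ hL hA hAL hi ?_ h
        rwa [hLord, hL] at hV)
    refine ⟨hg, ?_, ?_⟩
    · rw [hmap]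
      exact hne
    · rw [hmap, hmap, eq_div_iff hne]
      exact heq.symm
  have hpair₁ := hpair 1 A₁ rfl h₁ hA₁
  have hpair₂ := hpair 2 A₂ rfl h₂ hA₂
  -- A common divisor of the three operators divides L - λ and A₁ - μ₁, hence their greatest common
  -- right divisor.
  refine ⟨φ, ⟨hpair₁.1.monic, ?_, fun H hH => hpair₁.1.greatest H ?_⟩, ?_⟩
  · rintro P (rfl | rfl | rfl)
    exacts [hφ 0, hφ 1, hφ 2]
  · rintro P (rfl | rfl)
    exacts [hH _ (by simp), hH _ (by simp)]
  · rintro P (rfl | rfl)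
    exacts [hpair₁, hpair₂]

end
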